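/- Let $Q$ be a finite quiver with vertex set $Q_0$, let $I$ be a two-sided ideal of the path algebra $\mathbb{Z}Q$ such that $A=\mathbb{Z}Q/I$ is a $\mathbb{Z}$-order (that is, free and finitely generated as a $\mathbb{Z}$-module), and let $N_1,N_2,M$ be $A$-lattices, i.e. right $A$-modules that are free and finitely generated over $\mathbb{Z}$. For an $A$-lattice $N$ and $x\in Q_0$ put $N_x=Ne_x$, where $e_x$ is the trivial path at $x$, and $(\mathbf{dim}\,N)_x=\operatorname{rank}_{\mathbb{Z}}N_x$. For a field $K$ let $A^{(K)}=A\otimes_{\mathbb{Z}}K$ and $N^{(K)}=N\otimes_{\mathbb{Z}}K$. Write $\mathbf e=\mathbf{dim}\,N_1$ and $\mathbf d=\mathbf{dim}\,M$, and fix $\mathbb{Z}$-bases of the groups $M_x$, which identify $M_x\otimes_{\mathbb{Z}} K$ with $K^{\mathbf d_x}$ for every field $K$. Let $$\mathcal{E}(N_1^{(K)},N_2^{(K)};M^{(K)})=\{U\subseteq M^{(K)}\ \text{an } A^{(K)}\text{-submodule}: U\cong N_1^{(K)},\ M^{(K)}/U\cong N_2^{(K)}\},$$ regarded, via $U\mapsto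 (Ue_x)_{x\in Q_0}$, as a subset of the product of Grassmannians $\prod_{x\in Q_0}Gr_{\mathbf e_x}(\mathbf d_x,K)$. This product is regarded as a subset of the projective space $\mathbb{P}^n(K)$, $n+1=\prod_{x}\binom{\mathbf d_x}{\mathbf e_x}$, via the Plücker embeddings followed by the Segre embedding. For homogeneous polynomials $F_1,\dots,F_r\in\mathbb{Z}[T_0,\dots,T_n]$ let $V_K(F_1,\dots,F_r)\subseteq\mathbb{P}^n(K)$ be their set of common zeros. Then there exist a finite set $\Sigma$ of prime numbers and homogeneous polynomials $F_1,\dots,F_r,G_1,\dots,G_s\in\mathbb{Z}[T_0,\dots,T_n]$ such that $$\mathcal{E}(N_1^{(K)},N_2^{(K)};M^{(K)})=V_K(F_1,\dots,F_r)\setminus V_K(G_1,\dots,G_s)$$ for every field $K$ whose characteristic does not belong to $\Sigma$. (If $\mathbf e_x>\mathbf d_x$ for some $x$, there are no coordinates and both sides are empty.) -/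

import Mathlib

open scoped TensorProduct LinearAlgebra.Projectivization

noncomputable section

/-! ### Path algebras -/

/-- All paths in the quiver `Q`, as triples (start, end, path). -/
abbrev QuiverPath (Q : Type*) [Quiver Q] : Type _ := Σ x y : Q, Quiver.Path x y

/-- The path algebra `R Q`: the free `R`-module on the set of paths of `Q`. The product is
concatenation of paths: `p * q` means "first `p`, then `q`", and is `0` if the end of `p` is not
the start of `q`. -/
def PathAlgebra (R Q : Type*) [CommRing R] [Quiver Q] : Type _ := QuiverPath Q →₀ R

namespace PathAlgebra

variable {R Q : Type*} [CommRing R] [Quiver Q]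

instance : AddCommGroup (PathAlgebra R Q) := inferInstanceAs (AddCommGroup (QuiverPath Q →₀ R))

instance : Module R (PathAlgebra R Q) := inferInstanceAs (Module R (QuiverPath Q →₀ R))

/-- The basis element of the path algebra given by a path. -/
def ofPath (p : QuiverPath Q) : PathAlgebra R Q := Finsupp.single p (1 : R)

/-- The paths form a basis of the path algebra. -/
def pathBasis : Module.Basis (QuiverPath Q) R (PathAlgebra R Q) :=
  Module.Basis.ofRepr (LinearEquiv.refl R (QuiverPath Q →₀ R))

theorem pathBasis_apply (p : QuiverPath Q) : pathBasis (R := R) p = ofPath p := rfl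

open Classical in
/-- The product of two paths in the path algebra. -/
def pathMul (p q : QuiverPath Q) : PathAlgebra R Q :=
  if h : p.2.1 = q.1 then ofPath ⟨p.1, q.2.1, p.2.2.comp (q.2.2.cast h.symm rfl)⟩ else 0

/-- The multiplication of the path algebra as a bilinear map. -/
def mulLin : PathAlgebra R Q →ₗ[R] PathAlgebra R Q →ₗ[R] PathAlgebra R Q :=
  pathBasis.constr R fun p => pathBasis.constr R fun q => pathMul p q

instance : Mul (PathAlgebra R Q) := ⟨fun a b => mulLin a b⟩

theorem mul_def (a b : PathAlgebra R Q) : a * b = mulLin a b := rfl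

theorem mulLin_ofPath (p q : QuiverPath Q) :
    mulLin (R := R) (ofPath p) (ofPath q) = pathMul p q := by
  rw [mulLin, ← pathBasis_apply, ← pathBasis_apply, Module.Basis.constr_basis,
    Module.Basis.constr_basis]

theorem ofPath_mul_ofPath (p q : QuiverPath Q) :
    (ofPath p * ofPath q : PathAlgebra R Q) = pathMul p q := mulLin_ofPath p q

/-- The product of two composable paths is their composite. -/
theorem ofPath_mul_ofPath_comp {x y z : Q} (p : Quiver.Path x y) (q : Quiver.Path y z) :
    (ofPath ⟨x, y, p⟩ * ofPath ⟨y, z, q⟩ : PathAlgebra R Q) = ofPath ⟨x, z, p.comp q⟩ := by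
  simp [ofPath_mul_ofPath, pathMul]

/-- The product of two non-composable paths is zero. -/
theorem ofPath_mul_ofPath_of_ne {x y z w : Q} (p : Quiver.Path x y) (q : Quiver.Path z w)
    (h : y ≠ z) : (ofPath ⟨x, y, p⟩ * ofPath ⟨z, w, q⟩ : PathAlgebra R Q) = 0 := by
  simp [ofPath_mul_ofPath, pathMul, h]

theorem mulLin_assoc (a b c : PathAlgebra R Q) :
    mulLin (mulLin a b) c = mulLin a (mulLin b c) := by
  suffices H : (mulLin (R := R) (Q := Q)).compr₂ mulLin =
      (LinearMap.llcomp R _ _ _).flip mulLin ∘ₗ (LinearMap.llcomp R _ _ _ ∘ₗ mulLin) by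
    exact congrArg (fun f => f a b c) H
  refine pathBasis.ext fun p => pathBasis.ext fun q => pathBasis.ext fun r => ?_
  obtain ⟨x, y, p⟩ := p
  obtain ⟨z, w, q⟩ := q
  obtain ⟨u, v, r⟩ := r
  simp only [pathBasis_apply]
  change ofPath ⟨x, y, p⟩ * ofPath ⟨z, w, q⟩ * ofPath ⟨u, v, r⟩ =
    (ofPath ⟨x, y, p⟩ * (ofPath ⟨z, w, q⟩ * ofPath ⟨u, v, r⟩) : PathAlgebra R Q)
  have zl : ∀ a : PathAlgebra R Q, 0 * a = 0 := fun a => by simp [mul_def]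
  have zr : ∀ a : PathAlgebra R Q, a * 0 = 0 := fun a => by simp [mul_def]
  by_cases h1 : y = z
  · subst h1
    rw [ofPath_mul_ofPath_comp]
    by_cases h2 : w = u
    · subst h2
      simp only [ofPath_mul_ofPath_comp, Quiver.Path.comp_assoc]
    · rw [ofPath_mul_ofPath_of_ne _ _ h2, ofPath_mul_ofPath_of_ne _ _ h2, zr]
  · rw [ofPath_mul_ofPath_of_ne _ _ h1, zl]
    by_cases h2 : w = u
    · subst h2
      rw [ofPath_mul_ofPath_comp, ofPath_mul_ofPath_of_ne _ _ h1]
    · rw [ofPath_mul_ofPath_of_ne _ _ h2, zr]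

/-- The trivial path `e_x` at the vertex `x`. -/
def idem (R : Type*) [CommRing R] {Q : Type*} [Quiver Q] (x : Q) : PathAlgebra R Q :=
  ofPath ⟨x, x, Quiver.Path.nil⟩

instance [Fintype Q] : One (PathAlgebra R Q) := ⟨∑ x : Q, idem R x⟩

theorem one_def [Fintype Q] : (1 : PathAlgebra R Q) = ∑ x : Q, idem R x := rfl

theorem one_mulLin [Fintype Q] (a : PathAlgebra R Q) : mulLin 1 a = a := by
  suffices H : mulLin (1 : PathAlgebra R Q) = LinearMap.id from congrArg (fun f => f a) H
  refine pathBasis.ext fun q => ?_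
  obtain ⟨z, w, q⟩ := q
  rw [pathBasis_apply, one_def, map_sum, LinearMap.sum_apply, Finset.sum_eq_single z]
  · exact (ofPath_mul_ofPath_comp _ _).trans (by simp)
  · intro x _ hx
    exact ofPath_mul_ofPath_of_ne _ _ hx
  · simp

theorem mulLin_one [Fintype Q] (a : PathAlgebra R Q) : mulLin a 1 = a := by
  suffices H : mulLin.flip (1 : PathAlgebra R Q) = LinearMap.id from congrArg (fun f => f a) H
  refine pathBasis.ext fun q => ?_
  obtain ⟨z, w, q⟩ := q
  rw [pathBasis_apply, LinearMap.flip_apply, one_def, map_sum, Finset.sum_eq_single w]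
  · exact (ofPath_mul_ofPath_comp _ _).trans (by simp)
  · intro x _ hx
    exact ofPath_mul_ofPath_of_ne _ _ (Ne.symm hx)
  · simp

instance [Fintype Q] : Ring (PathAlgebra R Q) where
  __ := (inferInstance : AddCommGroup (PathAlgebra R Q))
  mul a b := a * b
  one := 1
  left_distrib a b c := (mulLin a).map_add b c
  right_distrib a b c := by
    change mulLin (a + b) c = mulLin a c + mulLin b c
    rw [map_add, LinearMap.add_apply]
  zero_mul a := by
    change mulLin 0 a = 0
    rw [map_zero, LinearMap.zero_apply]
  mul_zero a := (mulLin a).map_zero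
  mul_assoc a b c := mulLin_assoc a b c
  one_mul a := one_mulLin a
  mul_one a := mulLin_one a

end PathAlgebra

/-! ### Specialization of orders and lattices to a field

A right module over a ring `A` is a `Module Aᵐᵒᵖ N`. The specialization of `A` to a commutative
ring `K` is `K ⊗[ℤ] A`, that of a right `A`-module `N` is the right `K ⊗[ℤ] A`-module
`K ⊗[ℤ] N`, with `(d ⊗ n) (c ⊗ a) = d c ⊗ n a`. -/

section Specialization

variable (K A N : Type*) [CommRing K] [Ring A] [AddCommGroup N] [Module Aᵐᵒᵖ N]

/-- The right action of `A` on `N` by `ℤ`-linear maps. -/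
def rightActionHom : Aᵐᵒᵖ →ₐ[ℤ] Module.End ℤ N :=
  RingHom.toIntAlgHom
    { toFun := fun a => (DistribSMul.toAddMonoidHom N a).toIntLinearMap
      map_one' := by ext; simp
      map_mul' := fun a b => by ext; simp [mul_smul]
      map_zero' := by ext; simp
      map_add' := fun a b => by ext; simp [add_smul] }

/-- The action of `(K ⊗ A)ᵐᵒᵖ` on `K ⊗ N`. -/
def specializationHom : (K ⊗[ℤ] A)ᵐᵒᵖ →+* Module.End K (K ⊗[ℤ] N) :=
  RingHom.comp
    (Algebra.TensorProduct.lift (Algebra.ofId K (Module.End K (K ⊗[ℤ] N)))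
      ((Module.End.baseChangeHom ℤ K N).comp (rightActionHom A N))
      (fun c _ => Algebra.commutes c _) :
        K ⊗[ℤ] Aᵐᵒᵖ →ₐ[K] Module.End K (K ⊗[ℤ] N)).toRingHom
    (((Algebra.TensorProduct.congr (AlgEquiv.toOpposite ℤ K) AlgEquiv.refl).trans
      (Algebra.TensorProduct.opAlgEquiv ℤ ℤ K A)).symm : (K ⊗[ℤ] A)ᵐᵒᵖ ≃ₐ[ℤ] K ⊗[ℤ] Aᵐᵒᵖ).toRingHom

instance specializationModule : Module (K ⊗[ℤ] A)ᵐᵒᵖ (K ⊗[ℤ] N) :=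
  Module.compHom (K ⊗[ℤ] N) (specializationHom K A N)

variable {K A N}

theorem op_tmul_smul_tmul (c d : K) (a : A) (n : N) :
    MulOpposite.op (c ⊗ₜ[ℤ] a) • (d ⊗ₜ[ℤ] n) = (d * c) ⊗ₜ[ℤ] (MulOpposite.op a • n) := by
  change specializationHom K A N (MulOpposite.op (c ⊗ₜ[ℤ] a)) (d ⊗ₜ[ℤ] n) = _
  have h : specializationHom K A N (MulOpposite.op (c ⊗ₜ[ℤ] a)) (d ⊗ₜ[ℤ] n) =
      c • (d ⊗ₜ[ℤ] (MulOpposite.op a • n)) := by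
    simp [specializationHom]
    rfl
  rw [h, TensorProduct.smul_tmul', smul_eq_mul, mul_comm]

instance specialization_isScalarTower :
    IsScalarTower K (K ⊗[ℤ] A)ᵐᵒᵖ (K ⊗[ℤ] N) where
  smul_assoc k t v := by
    induction t using MulOpposite.rec' with
    | _ t =>
      induction t with
      | zero =>
        have h0 : (0 : (K ⊗[ℤ] A)ᵐᵒᵖ) • v = 0 := zero_smul (K ⊗[ℤ] A)ᵐᵒᵖ v
        rw [MulOpposite.op_zero, smul_zero, h0, smul_zero]
      | add t t' h h' => simp only [MulOpposite.op_add, smul_add, add_smul, h, h']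
      | tmul c a =>
        induction v with
        | zero => simp
        | add v v' h h' => simp only [smul_add, h, h']
        | tmul d n =>
          rw [← MulOpposite.op_smul, TensorProduct.smul_tmul', op_tmul_smul_tmul,
            op_tmul_smul_tmul, TensorProduct.smul_tmul']
          congr 1
          simp only [smul_eq_mul]
          ring

/-- `A` is a `ℤ`-order: a unital ring, free and finitely generated as a `ℤ`-module. -/
def IsZOrder (A : Type*) [Ring A] : Prop := Module.Free ℤ A ∧ Module.Finite ℤ A

/-- The right `A`-module `N` is an `A`-lattice: it is free and finitely generated over `ℤ`. -/
def IsLattice (A N : Type*) [Ring A] [AddCommGroup N] [Module Aᵐᵒᵖ N] : Prop :=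
  Module.Free ℤ N ∧ Module.Finite ℤ N

end Specialization

/-! ### Grassmannians, Plücker and Segre embeddings, projective zero sets -/

/-- `Gr_e(d, K)`: the `e`-dimensional subspaces of `K^d`. -/
def Gr (K : Type*) [Field K] (e d : ℕ) : Type _ :=
  {W : Submodule K (Fin d → K) // Module.finrank K W = e}

/-- The vector of maximal minors of an `e × d` matrix, indexed by the `e`-element subsets of the
set of columns (written as increasing sequences). -/
def maximalMinors {K : Type*} [Field K] {e d : ℕ} (B : Matrix (Fin e) (Fin d) K) :
    (Fin e ↪o Fin d) → K :=
  fun s => (B.submatrix id s).det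

theorem maximalMinors_ne_zero {K : Type*} [Field K] {e d : ℕ} (B : Matrix (Fin e) (Fin d) K)
    (hB : LinearIndependent K B.row) : maximalMinors B ≠ 0 := by
  obtain ⟨κ, a, ha, hspan, hli⟩ := exists_linearIndependent' K B.col
  have hrank : Module.finrank K (Submodule.span K (Set.range B.col)) = e := by
    rw [← Matrix.rank_eq_finrank_span_cols, hB.rank_matrix, Fintype.card_fin]
  have htop : Submodule.span K (Set.range B.col) = ⊤ :=
    Submodule.eq_top_of_finrank_eq (by rw [hrank]; simp)
  have : Finite κ := Finite.of_injective a ha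
  have : Fintype κ := Fintype.ofFinite κ
  have hcard : Fintype.card κ = e := by
    rw [← hrank, ← hspan]
    exact (finrank_span_eq_card hli).symm
  classical
  let S : Finset (Fin d) := Finset.univ.image a
  have hS : S.card = e := by
    rw [Finset.card_image_of_injective _ ha, Finset.card_univ, hcard]
  intro h0
  have h1 : (B.submatrix id (S.orderEmbOfFin hS)).det = 0 := congrFun h0 (S.orderEmbOfFin hS)
  have hr : Set.range (B.submatrix id (S.orderEmbOfFin hS)).col = Set.range (B.col ∘ a) := by
    have : (B.submatrix id (S.orderEmbOfFin hS)).col = B.col ∘ (S.orderEmbOfFin hS) := rfl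
    rw [this, Set.range_comp, Finset.range_orderEmbOfFin, Set.range_comp]
    simp [S]
  have hli' : LinearIndependent K (B.submatrix id (S.orderEmbOfFin hS)).col :=
    linearIndependent_of_top_le_span_of_card_eq_finrank (by rw [hr, hspan, htop]) (by simp)
  have := Matrix.linearIndependent_cols_iff_isUnit.1 hli'
  rw [Matrix.isUnit_iff_isUnit_det, h1] at this
  exact not_isUnit_zero this

/-- The matrix whose rows are the members of a basis of a subspace of `K^d`. -/
def basisMatrix {K : Type*} [Field K] {e d : ℕ} {W : Submodule K (Fin d → K)}
    (w : Module.Basis (Fin e) K W) : Matrix (Fin e) (Fin d) K :=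
  fun i j => (w i : Fin d → K) j

theorem maximalMinors_basisMatrix_ne_zero {K : Type*} [Field K] {e d : ℕ}
    {W : Submodule K (Fin d → K)} (w : Module.Basis (Fin e) K W) :
    maximalMinors (basisMatrix w) ≠ 0 :=
  maximalMinors_ne_zero _ (w.linearIndependent.map' W.subtype (Submodule.ker_subtype W))

/-- The Plücker embedding `Gr_e(d, K) → ℙ^{(d choose e) - 1}(K)`: the maximal minors of the matrix
of a basis of the subspace. -/
def plucker {K : Type*} [Field K] {e d : ℕ} (W : Gr K e d) : ℙ K ((Fin e ↪o Fin d) → K) :=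
  Projectivization.mk K _
    (maximalMinors_basisMatrix_ne_zero (Module.finBasisOfFinrankEq K W.1 W.2))

/-- The Plücker embedding may be computed with any basis. -/
theorem plucker_eq_mk {K : Type*} [Field K] {e d : ℕ} (W : Gr K e d)
    (w : Module.Basis (Fin e) K W.1) :
    plucker W = Projectivization.mk K _ (maximalMinors_basisMatrix_ne_zero w) := by
  set v := Module.finBasisOfFinrankEq K W.1 W.2 with hv
  rw [plucker, Projectivization.mk_eq_mk_iff']
  refine ⟨(w.toMatrix v).det, ?_⟩
  funext s
  have key : basisMatrix v = (w.toMatrix v).transpose * basisMatrix w := by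
    ext i j
    have h := congrArg (fun u : W.1 => (u : Fin d → K) j) (w.sum_toMatrix_smul_self v i)
    simp only [Submodule.coe_sum, Submodule.coe_smul, Finset.sum_apply, Pi.smul_apply,
      smul_eq_mul] at h
    simpa [basisMatrix, Matrix.mul_apply] using h.symm
  simp only [Pi.smul_apply, smul_eq_mul, maximalMinors]
  rw [← hv, key, ← Matrix.det_transpose (w.toMatrix v), ← Matrix.det_mul]
  rfl

/-- The Segre embedding of a finite product of projective spaces: the homogeneous coordinates of
the image are all the products of one coordinate from each factor. -/
def segre {K : Type*} [Field K] {Q : Type*} [Fintype Q] {ι : Q → Type*}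
    (p : ∀ x, ℙ K (ι x → K)) : ℙ K ((∀ x, ι x) → K) :=
  Projectivization.mk K (fun s => ∏ x, (p x).rep (s x)) (by
    have h : ∀ x, ∃ i, (p x).rep i ≠ 0 := fun x => Function.ne_iff.1 (p x).rep_nonzero
    choose s hs using h
    exact Function.ne_iff.2 ⟨s, Finset.prod_ne_zero_iff.2 fun x _ => hs x⟩)

/-- The Segre embedding may be computed with any homogeneous coordinates. -/
theorem segre_mk {K : Type*} [Field K] {Q : Type*} [Fintype Q] {ι : Q → Type*}
    (v : ∀ x, ι x → K) (hv : ∀ x, v x ≠ 0) (h : (fun s : ∀ x, ι x => ∏ x, v x (s x)) ≠ 0) :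
    segre (fun x => Projectivization.mk K (v x) (hv x)) = Projectivization.mk K _ h := by
  choose a ha using fun x => Projectivization.exists_smul_eq_mk_rep K (v x) (hv x)
  rw [segre, Projectivization.mk_eq_mk_iff']
  refine ⟨∏ x, (a x : K), ?_⟩
  funext s
  simp only [← ha, Pi.smul_apply, smul_eq_mul, Units.smul_def, Finset.prod_mul_distrib]

/-- `V_K(F)`: the points of projective space at which all the integral polynomials `F i` vanish
(for homogeneous `F i` this does not depend on the homogeneous coordinates of the point). -/
def projZeros (K : Type*) [Field K] {σ ρ : Type*} (F : ρ → MvPolynomial σ ℤ) : Set (ℙ K (σ → K)) :=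
  {p | ∀ i, MvPolynomial.aeval p.rep (F i) = 0}

/-! ### The varieties of submodules -/

section Submodules

variable {Q : Type*} [Quiver Q] [Fintype Q] (I : Ideal (PathAlgebra ℤ Q)) [I.IsTwoSided]

/-- `N_x = N e_x`, the group at the vertex `x` in the representation of `Q` corresponding to the
right `ℤQ/I`-module `N`. -/
def vertexPart (N : Type*) [AddCommGroup N] [Module (PathAlgebra ℤ Q ⧸ I)ᵐᵒᵖ N] (x : Q) :
    Submodule ℤ N :=
  LinearMap.range (rightActionHom (PathAlgebra ℤ Q ⧸ I) N
    (MulOpposite.op (Ideal.Quotient.mk I (PathAlgebra.idem ℤ x))))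

/-- The dimension vector of a lattice. -/
def dimVec (N : Type*) [AddCommGroup N] [Module (PathAlgebra ℤ Q ⧸ I)ᵐᵒᵖ N] (x : Q) : ℕ :=
  Module.finrank ℤ (vertexPart I N x)

/-- Let `b` be a `ℤ`-basis of `M_x`, identifying `M_x^{(K)}` with `K^d`. The subspace of `K^d`
corresponding to the part `U_x = U e_x = U ∩ M_x^{(K)}` at `x` of a submodule `U` of `M^{(K)}`. -/
def localSubspace (K : Type*) [Field K] {M : Type*} [AddCommGroup M]
    [Module (PathAlgebra ℤ Q ⧸ I)ᵐᵒᵖ M] {d : ℕ} {x : Q}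
    (b : Module.Basis (Fin d) ℤ (vertexPart I M x))
    (U : Submodule (K ⊗[ℤ] (PathAlgebra ℤ Q ⧸ I))ᵐᵒᵖ (K ⊗[ℤ] M)) :
    Submodule K (Fin d → K) :=
  (U.restrictScalars K).comap
    (Fintype.linearCombination K fun i => (1 : K) ⊗ₜ[ℤ] (b i : M))

/-- `𝓔(N₁^{(K)}, N₂^{(K)}; M^{(K)})`, the set of the submodules `U` of `M^{(K)}` with
`U ≅ N₁^{(K)}` and `M^{(K)}/U ≅ N₂^{(K)}`, as a subset of the product of the Grassmannians
`Gr_{(dim N₁)_x}((dim M)_x, K)`, where `M_x^{(K)}` is identified with a coordinate space by means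
of the bases `b x`. -/
def extensionSet (K : Type*) [Field K] (N₁ N₂ M : Type*)
    [AddCommGroup N₁] [Module (PathAlgebra ℤ Q ⧸ I)ᵐᵒᵖ N₁]
    [AddCommGroup N₂] [Module (PathAlgebra ℤ Q ⧸ I)ᵐᵒᵖ N₂]
    [AddCommGroup M] [Module (PathAlgebra ℤ Q ⧸ I)ᵐᵒᵖ M]
    (b : ∀ x, Module.Basis (Fin (dimVec I M x)) ℤ (vertexPart I M x)) :
    Set (∀ x, Gr K (dimVec I N₁ x) (dimVec I M x)) :=
  {W | ∃ U : Submodule (K ⊗[ℤ] (PathAlgebra ℤ Q ⧸ I))ᵐᵒᵖ (K ⊗[ℤ] M),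
    Nonempty (U ≃ₗ[(K ⊗[ℤ] (PathAlgebra ℤ Q ⧸ I))ᵐᵒᵖ] (K ⊗[ℤ] N₁)) ∧
    Nonempty (((K ⊗[ℤ] M) ⧸ U) ≃ₗ[(K ⊗[ℤ] (PathAlgebra ℤ Q ⧸ I))ᵐᵒᵖ] (K ⊗[ℤ] N₂)) ∧
    ∀ x, (W x).1 = localSubspace I K (b x) U}

end Submodules

end

/-!
The theorem is proved chart by chart. On the chart `T_s = 1` of the projective space, a point of the
image of the product of Grassmannians is represented by a unique tuple of matrices `B x` which are
the identity on the columns `s x`, and each entry of `B x` is zero or, up to sign, a homogeneous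
coordinate of the point (`chartMatrix`). Hence lying on the image is a closed condition
(`mem_image_segre_plucker_iff`, `exists_chart_equations`), and it remains to express by polynomials
in the `B x` that their row spaces form a submodule isomorphic to `N₁^{(K)}` with quotient
isomorphic to `N₂^{(K)}`.

Consider the linear system `ρ t * B * Φ = B * Φ * ρ₁ t` for a square matrix `Φ`, where `ρ t` and
`ρ₁ t` are the matrices by which generators of `A` act on `M` and `N₁`, and the columns of `B` form a
basis of the subspace (`subSystem`). If the subspace is a submodule isomorphic to `N₁^{(K)}`, then
`Φ` runs through the homomorphisms from `N₁^{(K)}` to it, so that the system has an invertible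
solution, and its space of solutions has the dimension of the endomorphism ring of `N₁^{(K)}`
(`rank_subSystem`). This dimension is given by the rank of an integral matrix, and is therefore
independent of `K` once finitely many characteristics are excluded (`exists_rank_map_intCast_eq`).
Among the systems of a fixed rank `r`, Cramer's rule describes all solutions polynomially wherever a
fixed minor of order `r` does not vanish, and the existence of an invertible generic solution
becomes the non-vanishing of a coefficient of a determinant. Thus the condition is: all minors of
order `r + 1` vanish, and one of finitely many products of a minor of order `r` with such a
coefficient does not (`exists_isLocClosedPoint_linearSystem`). The quotient is treated in the same
way, with the homomorphisms from `M^{(K)}` to `N₂^{(K)}` which vanish on the subspace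
(`quotSystem`).

Conversely, if the determinant of a generic solution is not the zero polynomial, then the column
space of `B` is a sum of images of homomorphisms, hence a submodule, and it is isomorphic to
`N₁^{(K)}` (`exists_submodule_equiv_of_genericDet_ne_zero`). Over an infinite field some
specialization of the generic solution is invertible. Over a finite field this may fail, but it
holds over a finite extension `L`; restricting scalars from `L` to `K` gives an isomorphism between
the powers with exponent `[L : K]`, and finite modules with isomorphic powers are isomorphic
(`nonempty_equiv_of_pi_equiv`), since the numbers of homomorphisms into a finite module determine
it.

Finally the descriptions in the charts are homogenized and multiplied by the coordinate which
defines the chart, so that outside the chart they impose no vanishing condition and never satisfy a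
non-vanishing one (`exists_projZeros_diff_of_charts`).
-/

noncomputable section

/-! ### Descent of isomorphisms -/

section Lovasz

variable {R X Y Z ι : Type*} [Ring R] [AddCommGroup X] [Module R X] [AddCommGroup Y] [Module R Y]
  [AddCommGroup Z] [Module R Z]

/-- Homomorphisms to a power which kill a given submodule are families of homomorphisms which
kill it. -/
def homPiKillingEquiv (N : Submodule R Z) :
    {f : Z →ₗ[R] (ι → X) // N ≤ LinearMap.ker f} ≃
      (ι → {f : Z →ₗ[R] X // N ≤ LinearMap.ker f}) where
  toFun f i := ⟨LinearMap.proj i ∘ₗ f.1, fun z hz => by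
    have := f.2 hz
    rw [LinearMap.mem_ker] at this
    simp [this]⟩
  invFun g := ⟨LinearMap.pi fun i => (g i).1, fun z hz => by
    rw [LinearMap.mem_ker]
    funext i
    exact (g i).2 hz⟩
  left_inv f := rfl
  right_inv g := rfl

/-- The number of homomorphisms into a power is a power of the number of homomorphisms into the
module, and taking roots is injective. -/
theorem card_hom_killing_eq [Finite X] [Finite Y] [Finite Z] [Finite ι] [Nonempty ι]
    (e : (ι → X) ≃ₗ[R] (ι → Y)) (N : Submodule R Z) :
    Nat.card {f : Z →ₗ[R] X // N ≤ LinearMap.ker f} =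
      Nat.card {f : Z →ₗ[R] Y // N ≤ LinearMap.ker f} := by
  have : Fintype ι := Fintype.ofFinite ι
  have h1 : Nat.card {f : Z →ₗ[R] (ι → X) // N ≤ LinearMap.ker f} =
      Nat.card {f : Z →ₗ[R] (ι → Y) // N ≤ LinearMap.ker f} :=
    Nat.card_congr
      { toFun := fun f => ⟨e.toLinearMap ∘ₗ f.1, by rw [LinearEquiv.ker_comp]; exact f.2⟩
        invFun := fun f => ⟨e.symm.toLinearMap ∘ₗ f.1, by rw [LinearEquiv.ker_comp]; exact f.2⟩
        left_inv := fun f => by ext; simp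
        right_inv := fun f => by ext; simp }
  rw [Nat.card_congr (homPiKillingEquiv N), Nat.card_congr (homPiKillingEquiv N), Nat.card_fun,
    Nat.card_fun] at h1
  exact Nat.pow_left_injective Nat.card_pos.ne' h1

theorem card_hom_killing_eq_sum [Finite X] [Finite Z] [Fintype (Submodule R Z)]
    [DecidableEq (Submodule R Z)] [DecidableLE (Submodule R Z)] (N : Submodule R Z) :
    Nat.card {f : Z →ₗ[R] X // N ≤ LinearMap.ker f} =
      Nat.card {f : Z →ₗ[R] X // LinearMap.ker f = N} +
        ∑ N' ∈ (Finset.univ.filter fun N' => N ≤ N').erase N,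
          Nat.card {f : Z →ₗ[R] X // LinearMap.ker f = N'} := by
  have hfX : Finite (Z →ₗ[R] X) := Finite.of_injective _ DFunLike.coe_injective
  have : Fintype (Z →ₗ[R] X) := Fintype.ofFinite _
  simp only [Nat.card_eq_fintype_card, Fintype.card_subtype]
  rw [Finset.add_sum_erase (Finset.univ.filter fun N' => N ≤ N')
      (fun N' => (Finset.univ.filter fun f : Z →ₗ[R] X => LinearMap.ker f = N').card) (by simp),
    Finset.card_eq_sum_card_fiberwise (f := fun f : Z →ₗ[R] X => LinearMap.ker f)
      (t := Finset.univ.filter fun N' => N ≤ N') (by intro f; simp)]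
  refine Finset.sum_congr rfl fun N' hN' => congrArg Finset.card ?_
  simp only [Finset.mem_filter, Finset.mem_univ, true_and] at hN'
  ext f
  simp only [Finset.mem_filter, Finset.mem_univ, true_and, and_iff_right_iff_imp]
  rintro rfl
  exact hN'

/-- By downward induction on the kernel, the number of homomorphisms that kill each submodule
determines the number of homomorphisms whose kernel is a given submodule. -/
theorem card_hom_ker_eq [Finite X] [Finite Y] [Finite Z]
    (h : ∀ N : Submodule R Z, Nat.card {f : Z →ₗ[R] X // N ≤ LinearMap.ker f} =
      Nat.card {f : Z →ₗ[R] Y // N ≤ LinearMap.ker f}) (N : Submodule R Z) :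
    Nat.card {f : Z →ₗ[R] X // LinearMap.ker f = N} =
      Nat.card {f : Z →ₗ[R] Y // LinearMap.ker f = N} := by
  classical
  have hfinS : Finite (Submodule R Z) := Finite.of_injective _ SetLike.coe_injective
  have : Fintype (Submodule R Z) := Fintype.ofFinite _
  induction N using WellFoundedGT.induction with
  | ind N ih =>
    have hN := h N
    rw [card_hom_killing_eq_sum, card_hom_killing_eq_sum,
      Finset.sum_congr rfl fun N' hN' => ih N' ?_] at hN
    · exact Nat.add_right_cancel hN
    · simp only [Finset.mem_erase, Finset.mem_filter, Finset.mem_univ, true_and] at hN'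
      exact lt_of_le_of_ne hN'.2 (Ne.symm hN'.1)

/-- The number of injective homomorphisms from `X` to `Y` is the number of those from `X` to `X`,
which include the identity. -/
theorem exists_injective_of_pi_equiv [Finite X] [Finite Y] [Finite ι] [Nonempty ι]
    (e : (ι → X) ≃ₗ[R] (ι → Y)) : ∃ f : X →ₗ[R] Y, Function.Injective f := by
  have h := card_hom_ker_eq (fun N : Submodule R X => card_hom_killing_eq e N) ⊥
  have hfX : Finite (X →ₗ[R] X) := Finite.of_injective _ DFunLike.coe_injective
  have : Nonempty {f : X →ₗ[R] X // LinearMap.ker f = ⊥} :=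
    ⟨⟨LinearMap.id, LinearMap.ker_id⟩⟩
  have hpos := Nat.card_pos (α := {f : X →ₗ[R] X // LinearMap.ker f = ⊥})
  rw [h] at hpos
  obtain ⟨⟨f, hf⟩⟩ := (Nat.card_pos_iff.1 hpos).1
  exact ⟨f, LinearMap.ker_eq_bot.1 hf⟩

/-- Lovász's cancellation of exponents: finite modules with isomorphic powers are isomorphic. -/
theorem nonempty_equiv_of_pi_equiv [Finite X] [Finite Y] [Finite ι] [Nonempty ι]
    (e : (ι → X) ≃ₗ[R] (ι → Y)) : Nonempty (X ≃ₗ[R] Y) := by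
  obtain ⟨f, hf⟩ := exists_injective_of_pi_equiv e
  obtain ⟨g, hg⟩ := exists_injective_of_pi_equiv e.symm
  have hcard : Nat.card X = Nat.card Y :=
    le_antisymm (Nat.card_le_card_of_injective f hf) (Nat.card_le_card_of_injective g hg)
  exact ⟨LinearEquiv.ofBijective f ((Nat.bijective_iff_injective_and_card f).2 ⟨hf, hcard⟩)⟩

end Lovasz

section Descent

variable {K R X Y J κ : Type*} [Field K] [Ring R] [Algebra K R]
  [AddCommGroup X] [Module R X] [Module K X] [IsScalarTower K R X] [FiniteDimensional K X]
  [AddCommGroup Y] [Module R Y] [Module K Y] [IsScalarTower K R Y] [FiniteDimensional K Y]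
  [Fintype J] [DecidableEq J] [Fintype κ]

/-- If a linear combination, over a finite extension field `L` of a finite field `K`, of the
matrices of homomorphisms `f c : X → Y` is invertible, then `X` and `Y` are isomorphic: the linear
combination gives an isomorphism between the powers of `X` and `Y` with exponent `[L : K]`. -/
theorem nonempty_equiv_of_det_ne_zero_of_finite [Finite K] {L : Type*} [Field L] [Algebra K L]
    [FiniteDimensional K L] (hXY : Module.finrank K X = Module.finrank K Y) (x : J → X)
    (γ : Module.Basis J K Y) (f : κ → X →ₗ[R] Y) (u : κ → L)
    (hu : (Matrix.of fun i j => ∑ c, u c * algebraMap K L (γ.repr (f c (x j)) i)).det ≠ 0) :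
    Nonempty (X ≃ₗ[R] Y) := by
  set Φ : Matrix J J L := Matrix.of fun i j => ∑ c, u c * algebraMap K L (γ.repr (f c (x j)) i)
    with hΦ
  have : Finite X := Module.finite_of_finite K
  have : Finite Y := Module.finite_of_finite K
  let ℓ := Module.finBasis K L
  have hι : Nonempty (Fin (Module.finrank K L)) := ⟨⟨0, Module.finrank_pos⟩⟩
  let F : (Fin (Module.finrank K L) → X) →ₗ[R] (Fin (Module.finrank K L) → Y) :=
    LinearMap.pi fun a => ∑ b, ∑ c, Algebra.leftMulMatrix ℓ (u c) a b • (f c ∘ₗ LinearMap.proj b)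
  have hF : ∀ y a, F y a = ∑ b, ∑ c, Algebra.leftMulMatrix ℓ (u c) a b • f c (y b) := by
    intro y a
    simp [F, LinearMap.sum_apply]
  -- `K`-linearity of the homomorphisms of `R`-modules
  have hK : ∀ c (k : K) (z : X), f c (k • z) = k • f c z := fun c k z => by
    rw [← algebraMap_smul R k z, map_smul, algebraMap_smul]
  -- Given `y`, solve `Φ w = y` over `L`; the coordinates of `w` over `K` are those of a preimage.
  have hsurj : Function.Surjective F := by
    intro y
    have hΦu : IsUnit Φ := by
      rw [Matrix.isUnit_iff_isUnit_det]
      exact isUnit_iff_ne_zero.2 hu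
    obtain ⟨w, hw⟩ := (Matrix.mulVec_surjective_iff_isUnit.2 hΦu)
      (fun i => ∑ a, γ.repr (y a) i • ℓ a)
    refine ⟨fun a => ∑ j, ℓ.repr (w j) a • x j, ?_⟩
    funext a
    have h1 : F (fun a => ∑ j, ℓ.repr (w j) a • x j) a =
        ∑ j, ∑ c, ℓ.repr (u c * w j) a • f c (x j) := by
      rw [hF]
      simp only [map_sum, hK, Finset.smul_sum, smul_smul]
      rw [Finset.sum_comm' (t' := Finset.univ) (s' := fun _ => Finset.univ) (by simp)]
      have : ∀ c, ∑ b, ∑ j, (Algebra.leftMulMatrix ℓ (u c) a b * ℓ.repr (w j) b) • f c (x j) =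
          ∑ j, ℓ.repr (u c * w j) a • f c (x j) := by
        intro c
        rw [Finset.sum_comm]
        refine Finset.sum_congr rfl fun j _ => ?_
        rw [← Finset.sum_smul, ← Algebra.leftMulMatrix_mulVec_repr]
        rfl
      rw [Finset.sum_congr rfl fun c _ => this c, Finset.sum_comm]
    rw [h1]
    refine γ.repr.injective ?_
    ext i
    have h2 : ∑ j, ∑ c, ℓ.repr (u c * w j) a * γ.repr (f c (x j)) i =
        ℓ.repr ((Φ.mulVec w) i) a := by
      simp only [Matrix.mulVec, dotProduct, hΦ, Matrix.of_apply, Finset.sum_mul, map_sum,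
        Finsupp.coe_finsetSum, Finset.sum_apply]
      refine Finset.sum_congr rfl fun j _ => Finset.sum_congr rfl fun c _ => ?_
      rw [mul_right_comm, mul_comm _ (algebraMap K L _), ← Algebra.smul_def, map_smul,
        Finsupp.smul_apply, smul_eq_mul, mul_comm]
    simp only [map_sum, map_smul, Finsupp.coe_finsetSum, Finset.sum_apply, Finsupp.smul_apply,
      smul_eq_mul]
    rw [h2, hw, Module.Basis.repr_sum_self]
  have hcard : Nat.card X = Nat.card Y :=
    Nat.card_congr (LinearEquiv.ofFinrankEq X Y hXY).toEquiv
  have hbij : Function.Bijective F :=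
    hsurj.bijective_of_nat_card_le (by rw [Nat.card_fun, Nat.card_fun, hcard])
  exact nonempty_equiv_of_pi_equiv (LinearEquiv.ofBijective F hbij)

/-- A variant of the Noether–Deuring theorem: two modules of the same finite dimension are
isomorphic if the determinant of a generic linear combination of homomorphisms `f c : X → Y` is not
zero as a polynomial. Over a finite field this does not require the polynomial to have a non-zero
value. -/
theorem nonempty_equiv_of_det_generic_ne_zero
    (hXY : Module.finrank K X = Module.finrank K Y) (x : J → X)
    (γ : Module.Basis J K Y) (f : κ → X →ₗ[R] Y)
    (h : (Matrix.of fun i j => ∑ c, MvPolynomial.X c *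
      MvPolynomial.C (γ.repr (f c (x j)) i) : Matrix J J (MvPolynomial κ K)).det ≠ 0) :
    Nonempty (X ≃ₗ[R] Y) := by
  have heval : ∀ (L : Type _) [Field L] [Algebra K L] (u : κ → L),
      MvPolynomial.aeval u (Matrix.of fun i j => ∑ c, MvPolynomial.X c *
        MvPolynomial.C (γ.repr (f c (x j)) i) : Matrix J J (MvPolynomial κ K)).det =
      (Matrix.of fun i j => ∑ c, u c * algebraMap K L (γ.repr (f c (x j)) i)).det := by
    intro L _ _ u
    rw [AlgHom.map_det]
    congr 1
    ext i j
    simp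
  set p := (Matrix.of fun i j => ∑ c, MvPolynomial.X c *
      MvPolynomial.C (γ.repr (f c (x j)) i) : Matrix J J (MvPolynomial κ K)).det with hp
  cases finite_or_infinite K with
  | inl hfin =>
    -- The polynomial has a non-zero value over the algebraic closure, hence over a finite
    -- extension.
    have h' : MvPolynomial.map (algebraMap K (AlgebraicClosure K)) p ≠ 0 := by
      intro h0
      exact h (MvPolynomial.map_injective _ (algebraMap K (AlgebraicClosure K)).injective
        (h0.trans (map_zero _).symm))
    obtain ⟨u, hu⟩ : ∃ u, MvPolynomial.eval u
        (MvPolynomial.map (algebraMap K (AlgebraicClosure K)) p) ≠ 0 := by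
      by_contra! H
      exact h' (MvPolynomial.funext fun u => by rw [H u, map_zero])
    rw [MvPolynomial.eval_map, ← MvPolynomial.aeval_def] at hu
    let L := IntermediateField.adjoin K (Set.range u)
    have : FiniteDimensional K L :=
      IntermediateField.finiteDimensional_adjoin fun z _ => Algebra.IsIntegral.isIntegral z
    let u' : κ → L := fun c => ⟨u c, IntermediateField.subset_adjoin K _ ⟨c, rfl⟩⟩
    have hu' : MvPolynomial.aeval u' p ≠ 0 := by
      intro h0
      have h1 := MvPolynomial.aeval_algebraMap_apply (AlgebraicClosure K) u' p
      rw [h0, map_zero] at h1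
      exact hu h1
    exact nonempty_equiv_of_det_ne_zero_of_finite hXY x γ f u' (by rw [← heval]; exact hu')
  | inr hinf =>
    obtain ⟨u, hu⟩ : ∃ u, MvPolynomial.eval u p ≠ 0 := by
      by_contra! H
      exact h (MvPolynomial.funext fun u => by rw [H u, map_zero])
    rw [← MvPolynomial.coe_aeval_eq_eval] at hu
    have hu2 : (Matrix.of fun i j => ∑ c, u c * algebraMap K K (γ.repr (f c (x j)) i)).det ≠ 0 := by
      rw [← heval]; exact hu
    let F : X →ₗ[R] Y := ∑ c, u c • f c
    have hsurj : Function.Surjective F := by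
      have h3 : γ.det (fun j => F (x j)) ≠ 0 := by
        rw [Module.Basis.det_apply]
        convert hu2 using 2
        ext i j
        simp [F, Module.Basis.toMatrix_apply]
      have h4 := ((γ.is_basis_iff_det (v := fun j => F (x j))).2 (isUnit_iff_ne_zero.2 h3)).2
      have h5 : LinearMap.range (F.restrictScalars K) = ⊤ := by
        rw [eq_top_iff, ← h4, Submodule.span_le]
        rintro _ ⟨j, rfl⟩
        exact ⟨x j, rfl⟩
      exact fun y => LinearMap.range_eq_top.1 h5 y
    have hinj : Function.Injective F :=
      (LinearMap.injective_iff_surjective_of_finrank_eq_finrank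
        (f := F.restrictScalars K) hXY).2 hsurj
    exact ⟨LinearEquiv.ofBijective F ⟨hinj, hsurj⟩⟩

end Descent

/-! ### Minors and rank -/

section Minors

theorem exists_linearIndependent_rows {K m n : Type*} [Field K] [Finite m] [Fintype n]
    (A : Matrix m n K) {r : ℕ} (hr : r ≤ A.rank) :
    ∃ R : Fin r → m, LinearIndependent K (A.submatrix R id).row := by
  obtain ⟨κ, a, ha, hspan, hli⟩ := exists_linearIndependent' K A.row
  have : Finite κ := Finite.of_injective a ha
  have : Fintype κ := Fintype.ofFinite κ
  have : Fintype m := Fintype.ofFinite m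
  have hcard : Fintype.card κ = A.rank := by
    rw [Matrix.rank_eq_finrank_span_row, ← hspan]
    exact (finrank_span_eq_card hli).symm
  obtain ⟨g⟩ : Nonempty (Fin r ↪ κ) := by
    rw [Function.Embedding.nonempty_iff_card_le, Fintype.card_fin, hcard]
    exact hr
  exact ⟨a ∘ g, hli.comp g g.injective⟩

theorem exists_minor_ne_zero {K m n : Type*} [Field K] [Finite m] [Fintype n]
    (A : Matrix m n K) {r : ℕ} (hr : r ≤ A.rank) :
    ∃ (R : Fin r → m) (C : Fin r → n), (A.submatrix R C).det ≠ 0 := by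
  obtain ⟨R, hR⟩ := exists_linearIndependent_rows A hr
  have h1 : (A.submatrix R id).transpose.rank = r := by
    rw [Matrix.rank_transpose, hR.rank_matrix, Fintype.card_fin]
  obtain ⟨C, hC⟩ := exists_linearIndependent_rows _ h1.ge
  refine ⟨R, C, ?_⟩
  have h2 := Matrix.linearIndependent_rows_iff_isUnit.1 hC
  rw [Matrix.isUnit_iff_isUnit_det] at h2
  rw [← Matrix.det_transpose]
  exact h2.ne_zero

theorem le_rank_of_minor_ne_zero {K m n : Type*} [Field K] [Fintype n]
    (A : Matrix m n K) {r : ℕ} {R : Fin r → m} {C : Fin r → n}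
    (h : (A.submatrix R C).det ≠ 0) : r ≤ A.rank := by
  have h1 : (A.submatrix R C).rank = r := by
    have := Matrix.rank_of_isUnit (A.submatrix R C)
      ((Matrix.isUnit_iff_isUnit_det _).2 (isUnit_iff_ne_zero.2 h))
    rwa [Fintype.card_fin] at this
  rw [← h1]
  exact Matrix.rank_submatrix_le A R C

theorem rank_le_of_minors_eq_zero {K m n : Type*} [Field K] [Finite m] [Fintype n]
    (A : Matrix m n K) {r : ℕ}
    (h : ∀ (R : Fin (r + 1) → m) (C : Fin (r + 1) → n), (A.submatrix R C).det = 0) :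
    A.rank ≤ r := by
  by_contra! H
  obtain ⟨R, C, hRC⟩ := exists_minor_ne_zero A (Nat.succ_le_of_lt H)
  exact hRC (h R C)

theorem det_submatrix_map_intCast {m n K : Type*} [CommRing K] (A : Matrix m n ℤ) {k : ℕ}
    (R : Fin k → m) (C : Fin k → n) :
    ((A.map (Int.castRingHom K)).submatrix R C).det = (((A.submatrix R C).det : ℤ) : K) := by
  rw [← eq_intCast (Int.castRingHom K) (A.submatrix R C).det, RingHom.map_det]
  rfl

theorem intCast_ne_zero_of_ringChar_notMem {K : Type*} [Field K] {a : ℤ} (ha : a ≠ 0)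
    (hK : ringChar K ∉ a.natAbs.primeFactors) : (a : K) ≠ 0 := by
  intro h0
  have hdvd : ringChar K ∣ a.natAbs := Int.natCast_dvd.1 ((CharP.intCast_eq_zero_iff K _ a).1 h0)
  rcases CharP.char_is_prime_or_zero K (ringChar K) with hp | hp
  · exact hK (Nat.mem_primeFactors.2 ⟨hp, hdvd, Int.natAbs_ne_zero.2 ha⟩)
  · rw [hp, zero_dvd_iff, Int.natAbs_eq_zero] at hdvd
    exact ha hdvd

/-- The rank of an integral matrix over a field depends on the field only through its
characteristic, and is the same for all but finitely many characteristics. -/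
theorem exists_rank_map_intCast_eq {m n : Type*} [Fintype m] [Fintype n] (A : Matrix m n ℤ) :
    ∃ (S : Finset ℕ) (r : ℕ), (∀ p ∈ S, p.Prime) ∧ ∀ (K : Type*) [Field K], ringChar K ∉ S →
      (A.map (Int.castRingHom K)).rank = r := by
  set r := (A.map (Int.castRingHom ℚ)).rank with hr
  obtain ⟨R, C, hRC⟩ := exists_minor_ne_zero (A.map (Int.castRingHom ℚ)) hr.le
  rw [det_submatrix_map_intCast, Int.cast_ne_zero] at hRC
  refine ⟨(A.submatrix R C).det.natAbs.primeFactors, r,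
    fun p hp => Nat.prime_of_mem_primeFactors hp, fun K _ hK => le_antisymm ?_ ?_⟩
  · refine rank_le_of_minors_eq_zero _ fun R' C' => ?_
    have h0 : (A.submatrix R' C').det = 0 := by
      by_contra h
      have := le_rank_of_minor_ne_zero (A.map (Int.castRingHom ℚ)) (R := R') (C := C')
        (by rw [det_submatrix_map_intCast, Int.cast_ne_zero]; exact h)
      omega
    rw [det_submatrix_map_intCast, h0, Int.cast_zero]
  · refine le_rank_of_minor_ne_zero _ (R := R) (C := C) ?_
    rw [det_submatrix_map_intCast]
    exact intCast_ne_zero_of_ringChar_notMem hRC hK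

end Minors

/-! ### Generic invertibility on the solution space of a linear system -/

section LinearSystem

/-- The condition that all members of `F`, but not all members of `G`, vanish at `v`. -/
def IsLocClosedPoint {τ K : Type*} [Field K] (F G : Finset (MvPolynomial τ ℤ)) (v : τ → K) : Prop :=
  (∀ f ∈ F, MvPolynomial.aeval v f = 0) ∧ ∃ g ∈ G, MvPolynomial.aeval v g ≠ 0

theorem isLocClosedPoint_union_image₂_mul {τ K : Type*} [Field K]
    [DecidableEq (MvPolynomial τ ℤ)]
    (F G F' G' : Finset (MvPolynomial τ ℤ)) (v : τ → K) :
    IsLocClosedPoint (F ∪ F') (Finset.image₂ (· * ·) G G') v ↔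
      IsLocClosedPoint F G v ∧ IsLocClosedPoint F' G' v := by
  constructor
  · rintro ⟨h1, g, hg, hg0⟩
    obtain ⟨a, ha, b, hb, rfl⟩ := Finset.mem_image₂.1 hg
    rw [map_mul] at hg0
    exact ⟨⟨fun f hf => h1 f (Finset.mem_union_left _ hf), a, ha, left_ne_zero_of_mul hg0⟩,
      ⟨fun f hf => h1 f (Finset.mem_union_right _ hf), b, hb, right_ne_zero_of_mul hg0⟩⟩
  · rintro ⟨⟨h1, a, ha, ha0⟩, h2, b, hb, hb0⟩
    refine ⟨fun f hf => (Finset.mem_union.1 hf).elim (h1 f) (h2 f), a * b,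
      Finset.mem_image₂_of_mem ha hb, ?_⟩
    rw [map_mul]
    exact mul_ne_zero ha0 hb0

variable {ε κ I J : Type*} {r : ℕ}

/-- For a matrix `A` and rows `R`, columns `C` of the same number, the matrix obtained by Cramer's
rule whose columns solve the subsystem `R` of the linear system `A * z = 0`: multiply `z` by the
minor with rows `R` and columns `C`, and correct the unknowns in `C`. -/
def cramerSolutions [DecidableEq κ] {P : Type*} [CommRing P] (A : Matrix ε κ P)
    (R : Fin r → ε) (C : Fin r → κ) : Matrix κ κ P :=
  (A.submatrix R C).det • (1 : Matrix κ κ P) -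
    (1 : Matrix κ κ P).submatrix id C * ((A.submatrix R C).adjugate * A.submatrix R id)

theorem submatrix_mul_cramerSolutions [Fintype κ] [DecidableEq κ] {P : Type*} [CommRing P]
    (A : Matrix ε κ P) (R : Fin r → ε) (C : Fin r → κ) :
    A.submatrix R id * cramerSolutions A R C = 0 := by
  have h1 : A.submatrix R id * (1 : Matrix κ κ P).submatrix id C = A.submatrix R C := by
    rw [← Matrix.submatrix_mul A 1 R id C Function.bijective_id, Matrix.mul_one]
  rw [cramerSolutions, Matrix.mul_sub, ← Matrix.mul_assoc, h1, ← Matrix.mul_assoc,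
    Matrix.mul_adjugate, Matrix.mul_smul, Matrix.mul_one, Matrix.smul_mul, Matrix.one_mul, sub_self]

theorem cramerSolutions_mulVec [Fintype κ] [DecidableEq κ] {P : Type*} [CommRing P]
    (A : Matrix ε κ P) (R : Fin r → ε) (C : Fin r → κ) (z : κ → P)
    (hz : (A.submatrix R id).mulVec z = 0) :
    (cramerSolutions A R C).mulVec z = (A.submatrix R C).det • z := by
  rw [cramerSolutions, Matrix.sub_mulVec, ← Matrix.mulVec_mulVec, ← Matrix.mulVec_mulVec, hz,
    Matrix.mulVec_zero, Matrix.mulVec_zero, sub_zero, Matrix.smul_mulVec, Matrix.one_mulVec]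

theorem map_cramerSolutions [DecidableEq κ] {P P' : Type*} [CommRing P] [CommRing P'] (φ : P →+* P')
    (A : Matrix ε κ P) (R : Fin r → ε) (C : Fin r → κ) :
    (cramerSolutions A R C).map φ = cramerSolutions (A.map φ) R C := by
  have h1 : ((A.map φ).submatrix R C) = φ.mapMatrix (A.submatrix R C) := rfl
  have h2 : ((A.map φ).submatrix R id) = (A.submatrix R id).map φ := rfl
  have h3 : ((1 : Matrix κ κ P').submatrix id C) = ((1 : Matrix κ κ P).submatrix id C).map φ := by
    rw [← Matrix.submatrix_map, Matrix.map_one φ (map_zero φ) (map_one φ)]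
  rw [cramerSolutions, cramerSolutions, h1, h2, h3, ← RingHom.map_adjugate, ← RingHom.map_det,
    RingHom.mapMatrix_apply, ← Matrix.map_mul, ← Matrix.map_mul, Matrix.map_sub φ (map_sub φ)]
  congr 1
  ext i j
  by_cases hij : i = j <;> simp [hij]

variable [Fintype κ] [Fintype I] [DecidableEq I]

/-- The determinant formed by the columns `c` of the `I × J` matrix of unknowns of a linear system,
evaluated at the generic linear combination of the columns of `Z`. -/
def genericDet {P : Type*} [CommRing P] (Z : Matrix (I × J) κ P) (c : I → J) : MvPolynomial κ P :=
  (Matrix.of fun i j => ∑ k, MvPolynomial.X k * MvPolynomial.C (Z (i, c j) k)).det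

theorem map_genericDet {P P' : Type*} [CommRing P] [CommRing P'] (φ : P →+* P')
    (Z : Matrix (I × J) κ P) (c : I → J) :
    MvPolynomial.map φ (genericDet Z c) = genericDet (Z.map φ) c := by
  rw [genericDet, genericDet, RingHom.map_det]
  congr 1
  ext i j
  simp

theorem eval_genericDet {P : Type*} [CommRing P] (Z : Matrix (I × J) κ P) (c : I → J) (u : κ → P) :
    MvPolynomial.eval u (genericDet Z c) =
      (Matrix.of fun i j => Z.mulVec u (i, c j)).det := by
  rw [genericDet, RingHom.map_det]
  congr 1
  ext i j
  simp [Matrix.mulVec, dotProduct, mul_comm]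

/-- In a linear system of rank at most `r`, the equations which contain a non-zero minor of order
`r` imply all the others. -/
theorem ker_submatrix_eq_of_minor_ne_zero {K : Type*} [Field K] (A : Matrix ε κ K)
    (hA : A.rank ≤ r) {R : Fin r → ε} {C : Fin r → κ} (h : (A.submatrix R C).det ≠ 0) {z : κ → K}
    (hz : (A.submatrix R id).mulVec z = 0) : A.mulVec z = 0 := by
  have hle : LinearMap.ker A.mulVecLin ≤ LinearMap.ker (A.submatrix R id).mulVecLin := by
    intro y hy
    rw [LinearMap.mem_ker, Matrix.mulVecLin_apply] at hy ⊢
    funext i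
    exact congrFun hy (R i)
  have hr : r ≤ (A.submatrix R id).rank :=
    le_rank_of_minor_ne_zero (A.submatrix R id) (R := id) (C := C) h
  have h1 := A.mulVecLin.finrank_range_add_finrank_ker
  have h2 := (A.submatrix R id).mulVecLin.finrank_range_add_finrank_ker
  have heq : LinearMap.ker A.mulVecLin = LinearMap.ker (A.submatrix R id).mulVecLin := by
    refine Submodule.eq_of_le_of_finrank_le hle ?_
    unfold Matrix.rank at hA hr
    omega
  have : z ∈ LinearMap.ker A.mulVecLin := by
    rw [heq]
    exact hz
  exact this

variable [Fintype J] [DecidableEq J] [Fintype ε]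

open Classical in
/-- For a linear system in the entries of an `I × J` matrix, whose coefficients are integral
polynomials in parameters, the conditions on the parameters that the system has rank `r` and that
its generic solution has a non-zero minor, formed by columns `c`, define a locally closed set. On
this set the columns of some matrix `Z` are solutions which have such a minor generically; in the
other direction a single solution with a non-zero minor suffices. -/
theorem exists_isLocClosedPoint_linearSystem {τ : Type*}
    (A : Matrix ε (I × J) (MvPolynomial τ ℤ)) (r : ℕ) :
    ∃ F G : Finset (MvPolynomial τ ℤ), ∀ (K : Type*) [Field K] (v : τ → K),
      (IsLocClosedPoint F G v → ∃ Z : Matrix (I × J) (I × J) K,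
        A.map (MvPolynomial.aeval v) * Z = 0 ∧ ∃ c : I → J, genericDet Z c ≠ 0) ∧
      ((A.map (MvPolynomial.aeval v)).rank = r → ∀ z : I × J → K,
        (A.map (MvPolynomial.aeval v)).mulVec z = 0 →
        ∀ c : I → J, (Matrix.of fun i j => z (i, c j)).det ≠ 0 → IsLocClosedPoint F G v) := by
  let D : (Fin r → ε) × (Fin r → I × J) × (I → J) → MvPolynomial (I × J) (MvPolynomial τ ℤ) :=
    fun t => genericDet (cramerSolutions A t.1 t.2.1) t.2.2
  refine ⟨Finset.univ.image fun t : (Fin (r + 1) → ε) × (Fin (r + 1) → I × J) =>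
      (A.submatrix t.1 t.2).det,
    Finset.univ.biUnion fun t => (D t).support.image fun α =>
      (A.submatrix t.1 t.2.1).det * (D t).coeff α, fun K _ v => ?_⟩
  have hdet : ∀ {k : ℕ} (R : Fin k → ε) (C : Fin k → I × J),
      ((A.map (MvPolynomial.aeval v)).submatrix R C).det =
        MvPolynomial.aeval v (A.submatrix R C).det := fun R C => by
    rw [AlgHom.map_det]
    rfl
  have hD : ∀ t, MvPolynomial.map (MvPolynomial.aeval v : _ →ₐ[ℤ] K).toRingHom (D t) =
      genericDet (cramerSolutions (A.map (MvPolynomial.aeval v)) t.1 t.2.1) t.2.2 := fun t => by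
    rw [map_genericDet, map_cramerSolutions]
    rfl
  constructor
  · rintro ⟨hF, g, hg, hg0⟩
    obtain ⟨t, _, ht⟩ := Finset.mem_biUnion.1 hg
    obtain ⟨α, _, rfl⟩ := Finset.mem_image.1 ht
    rw [map_mul] at hg0
    have hminor : ((A.map (MvPolynomial.aeval v)).submatrix t.1 t.2.1).det ≠ 0 := by
      rw [hdet]
      exact left_ne_zero_of_mul hg0
    have hrank : (A.map (MvPolynomial.aeval v : _ →ₐ[ℤ] K)).rank ≤ r := by
      refine rank_le_of_minors_eq_zero _ fun R C => ?_
      rw [hdet]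
      exact hF _ (Finset.mem_image.2 ⟨(R, C), Finset.mem_univ _, rfl⟩)
    refine ⟨cramerSolutions (A.map (MvPolynomial.aeval v)) t.1 t.2.1, ?_, t.2.2, ?_⟩
    · ext i j
      have h1 := submatrix_mul_cramerSolutions (A.map (MvPolynomial.aeval v : _ →ₐ[ℤ] K)) t.1 t.2.1
      have h2 := ker_submatrix_eq_of_minor_ne_zero _ hrank hminor
        (z := fun k => cramerSolutions (A.map (MvPolynomial.aeval v)) t.1 t.2.1 k j) (by
          funext i'
          exact congrFun (congrFun h1 i') j)
      exact congrFun h2 i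
    · rw [← hD]
      intro h0
      have := congrArg (MvPolynomial.coeff α) h0
      rw [MvPolynomial.coeff_map, MvPolynomial.coeff_zero] at this
      exact right_ne_zero_of_mul hg0 this
  · intro hr z hz c hc
    refine ⟨fun f hf => ?_, ?_⟩
    · obtain ⟨t, _, rfl⟩ := Finset.mem_image.1 hf
      rw [← hdet]
      by_contra h
      have := le_rank_of_minor_ne_zero _ h
      omega
    · obtain ⟨R, C, hRC⟩ := exists_minor_ne_zero (A.map (MvPolynomial.aeval v : _ →ₐ[ℤ] K)) hr.ge
      have h1 := cramerSolutions_mulVec (A.map (MvPolynomial.aeval v : _ →ₐ[ℤ] K)) R C z (by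
        funext i
        exact congrFun hz (R i))
      -- the given solution is a value of the generic one, up to the minor
      have h2 : MvPolynomial.eval z (genericDet (cramerSolutions
          (A.map (MvPolynomial.aeval v : _ →ₐ[ℤ] K)) R C) c) ≠ 0 := by
        rw [eval_genericDet, h1]
        have : (Matrix.of fun i j => (((A.map (MvPolynomial.aeval v : _ →ₐ[ℤ] K)).submatrix R
            C).det • z) (i, c j)) = ((A.map (MvPolynomial.aeval v : _ →ₐ[ℤ] K)).submatrix R
            C).det • (Matrix.of fun i j => z (i, c j)) := rfl
        rw [this, Matrix.det_smul]
        exact mul_ne_zero (pow_ne_zero _ hRC) hc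
      have h3 : MvPolynomial.map (MvPolynomial.aeval v : _ →ₐ[ℤ] K).toRingHom (D (R, C, c)) ≠ 0 := by
        rw [hD]
        rintro h0
        exact h2 (by rw [h0, map_zero])
      obtain ⟨α, hα⟩ := MvPolynomial.ne_zero_iff.1 h3
      rw [MvPolynomial.coeff_map] at hα
      refine ⟨(A.submatrix R C).det * (D (R, C, c)).coeff α, ?_, ?_⟩
      · refine Finset.mem_biUnion.2 ⟨(R, C, c), Finset.mem_univ _, Finset.mem_image.2 ⟨α, ?_, rfl⟩⟩
        rw [MvPolynomial.mem_support_iff]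
        intro h0
        rw [h0, map_zero] at hα
        exact hα rfl
      · rw [map_mul, ← hdet]
        exact mul_ne_zero hRC hα

end LinearSystem

/-! ### Gluing conditions on affine charts of projective space -/

section Charts

open MvPolynomial

variable {σ : Type*}

theorem aeval_smul_of_isHomogeneous {K : Type*} [Field K] {n : ℕ} {f : MvPolynomial σ ℤ}
    (hf : f.IsHomogeneous n) (a : K) (v : σ → K) : aeval (a • v) f = a ^ n * aeval v f := by
  rw [aeval_def, aeval_def, eval₂_eq, eval₂_eq, Finset.mul_sum]
  refine Finset.sum_congr rfl fun d hd => ?_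
  have hdeg : ∑ i ∈ d.support, d i = n := by
    have h1 : d.degree = n := (DFunLike.congr_fun Finsupp.degree_eq_weight_one d).trans
      (hf (mem_support_iff.1 hd))
    rwa [Finsupp.degree_apply] at h1
  simp only [Pi.smul_apply, smul_eq_mul, mul_pow, Finset.prod_mul_distrib]
  rw [Finset.prod_pow_eq_pow_sum, hdeg]
  ring

/-- The homogenization of `f` with respect to the variable `X s`, multiplied once more by `X s` so
that it vanishes where `X s` does. -/
def chartHomogenization (s : σ) (f : MvPolynomial σ ℤ) : MvPolynomial σ ℤ :=
  ∑ k ∈ Finset.range (f.totalDegree + 1),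
    X s ^ (f.totalDegree + 1 - k) * homogeneousComponent k f

theorem isHomogeneous_chartHomogenization (s : σ) (f : MvPolynomial σ ℤ) :
    (chartHomogenization s f).IsHomogeneous (f.totalDegree + 1) := by
  refine IsHomogeneous.sum _ _ _ fun k hk => ?_
  have h1 := ((isHomogeneous_X ℤ s).pow (f.totalDegree + 1 - k)).mul
    (homogeneousComponent_isHomogeneous k f)
  have h2 : 1 * (f.totalDegree + 1 - k) + k = f.totalDegree + 1 := by
    have := Finset.mem_range.1 hk
    omega
  rwa [h2] at h1

theorem aeval_chartHomogenization_of_eq_zero {K : Type*} [Field K] {s : σ} {v : σ → K}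
    (hv : v s = 0) (f : MvPolynomial σ ℤ) : aeval v (chartHomogenization s f) = 0 := by
  rw [chartHomogenization, map_sum]
  refine Finset.sum_eq_zero fun k hk => ?_
  have := Finset.mem_range.1 hk
  rw [map_mul, map_pow, aeval_X, hv, zero_pow (by omega), zero_mul]

theorem aeval_chartHomogenization_smul {K : Type*} [Field K] {s : σ} {v : σ → K}
    (hv : v s = 1) (a : K) (f : MvPolynomial σ ℤ) :
    aeval (a • v) (chartHomogenization s f) = a ^ (f.totalDegree + 1) * aeval v f := by
  have h1 : aeval v f = aeval v (chartHomogenization s f) := by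
    conv_lhs => rw [← sum_homogeneousComponent f]
    simp [chartHomogenization, hv]
  rw [h1]
  exact aeval_smul_of_isHomogeneous (isHomogeneous_chartHomogenization s f) a v

/-- A family of subsets of projective spaces which is given, on every standard affine chart, by the
vanishing of some integral polynomials and the non-vanishing of others, is so given globally by
homogeneous polynomials. -/
theorem exists_projZeros_diff_of_charts [Finite σ] (S : Finset ℕ)
    (E : ∀ (K : Type*) [Field K], Set (ℙ K (σ → K)))
    (h : ∀ s : σ, ∃ F G : Finset (MvPolynomial σ ℤ), ∀ (K : Type _) [Field K], ringChar K ∉ S →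
      ∀ (v : σ → K) (hv : v ≠ 0), v s = 1 →
        (Projectivization.mk K v hv ∈ E K ↔ IsLocClosedPoint F G v)) :
    ∃ (m n : ℕ) (F : Fin m → MvPolynomial σ ℤ) (G : Fin n → MvPolynomial σ ℤ),
      (∀ i, ∃ d, (F i).IsHomogeneous d) ∧ (∀ j, ∃ d, (G j).IsHomogeneous d) ∧
      ∀ (K : Type _) [Field K], ringChar K ∉ S → E K = projZeros K F \ projZeros K G := by
  have := Fintype.ofFinite σ
  choose F G hFG using h
  let eF := Fintype.equivFin (Σ s, F s)
  let eG := Fintype.equivFin (Σ s, G s)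
  refine ⟨_, _, fun i => chartHomogenization (eF.symm i).1 (eF.symm i).2.1,
    fun i => chartHomogenization (eG.symm i).1 (eG.symm i).2.1,
    fun i => ⟨_, isHomogeneous_chartHomogenization _ _⟩,
    fun i => ⟨_, isHomogeneous_chartHomogenization _ _⟩, fun K _ hK => ?_⟩
  ext p
  -- the homogeneous coordinates of `p`, normalized on the chart `s`
  have hnorm : ∀ s, p.rep s ≠ 0 → ∃ (w : σ → K) (hw : w ≠ 0),
      w s = 1 ∧ p.rep = p.rep s • w ∧ Projectivization.mk K w hw = p := by
    intro s hs
    have hw : (p.rep s)⁻¹ • p.rep ≠ 0 := smul_ne_zero (inv_ne_zero hs) p.rep_nonzero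
    refine ⟨(p.rep s)⁻¹ • p.rep, hw, ?_, ?_, ?_⟩
    · simp [hs]
    · rw [smul_smul, mul_inv_cancel₀ hs, one_smul]
    · conv_rhs => rw [← p.mk_rep]
      exact (Projectivization.mk_eq_mk_iff' K _ _ _ _).2 ⟨_, rfl⟩
  have hF : p ∈ projZeros K (fun i => chartHomogenization (eF.symm i).1 (eF.symm i).2.1) ↔
      ∀ s, ∀ f ∈ F s, aeval p.rep (chartHomogenization s f) = 0 := by
    constructor
    · intro hp s f hf
      have := hp (eF ⟨s, f, hf⟩)
      dsimp only at this
      rwa [Equiv.symm_apply_apply] at this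
    · intro hp i
      exact hp _ _ (eF.symm i).2.2
  have hG : p ∈ projZeros K (fun i => chartHomogenization (eG.symm i).1 (eG.symm i).2.1) ↔
      ∀ s, ∀ f ∈ G s, aeval p.rep (chartHomogenization s f) = 0 := by
    constructor
    · intro hp s f hf
      have := hp (eG ⟨s, f, hf⟩)
      dsimp only at this
      rwa [Equiv.symm_apply_apply] at this
    · intro hp i
      exact hp _ _ (eG.symm i).2.2
  rw [Set.mem_sdiff, hF, hG]
  constructor
  · intro hp
    refine ⟨fun s f hf => ?_, fun H => ?_⟩
    · by_cases hs : p.rep s = 0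
      · exact aeval_chartHomogenization_of_eq_zero hs f
      · obtain ⟨w, hw, hw1, hpw, hmk⟩ := hnorm s hs
        rw [hpw, aeval_chartHomogenization_smul hw1,
          ((hFG s K hK w hw hw1).1 (hmk ▸ hp)).1 f hf, mul_zero]
    · obtain ⟨s, hs⟩ := Function.ne_iff.1 p.rep_nonzero
      obtain ⟨w, hw, hw1, hpw, hmk⟩ := hnorm s hs
      obtain ⟨g, hg, hg0⟩ := ((hFG s K hK w hw hw1).1 (hmk ▸ hp)).2
      have := H s g hg
      rw [hpw, aeval_chartHomogenization_smul hw1] at this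
      exact mul_ne_zero (pow_ne_zero _ hs) hg0 this
  · rintro ⟨h1, h2⟩
    push Not at h2
    obtain ⟨s, g, hg, hg0⟩ := h2
    have hs : p.rep s ≠ 0 := fun hs => hg0 (aeval_chartHomogenization_of_eq_zero hs g)
    obtain ⟨w, hw, hw1, hpw, hmk⟩ := hnorm s hs
    rw [← hmk]
    refine (hFG s K hK w hw hw1).2 ⟨fun f hf => ?_, g, hg, ?_⟩
    · have := h1 s f hf
      rw [hpw, aeval_chartHomogenization_smul hw1] at this
      exact (mul_eq_zero.1 this).resolve_left (pow_ne_zero _ hs)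
    · rw [hpw, aeval_chartHomogenization_smul hw1] at hg0
      exact right_ne_zero_of_mul hg0

end Charts

/-! ### Charts of the product of Grassmannians -/

section GrassmannCharts

section Single

variable {K : Type*} [Field K] {e d : ℕ}

theorem linearIndependent_row_of_submatrix_eq_one {B : Matrix (Fin e) (Fin d) K}
    {s : Fin e ↪o Fin d} (hB : B.submatrix id s = 1) : LinearIndependent K B.row := by
  have h1 : LinearIndependent K (B.submatrix id s).row :=
    Matrix.linearIndependent_rows_iff_isUnit.2 (hB ▸ isUnit_one)
  exact LinearIndependent.of_comp (LinearMap.funLeft K K s) h1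

/-- The row space of a matrix with `e` rows which is the identity matrix on the columns `s`. -/
def rowGr (B : Matrix (Fin e) (Fin d) K) (s : Fin e ↪o Fin d) (hB : B.submatrix id s = 1) :
    Gr K e d :=
  ⟨Submodule.span K (Set.range B.row), by
    rw [finrank_span_eq_card (linearIndependent_row_of_submatrix_eq_one hB), Fintype.card_fin]⟩

theorem plucker_rowGr (B : Matrix (Fin e) (Fin d) K) (s : Fin e ↪o Fin d)
    (hB : B.submatrix id s = 1) :
    plucker (rowGr B s hB) = Projectivization.mk K (maximalMinors B)
      (maximalMinors_ne_zero B (linearIndependent_row_of_submatrix_eq_one hB)) := by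
  have h : basisMatrix (W := (rowGr B s hB).1)
      (Module.Basis.span (linearIndependent_row_of_submatrix_eq_one hB)) = B := by
    ext i j
    exact congrFun (congrArg Subtype.val
      (Module.Basis.span_apply (linearIndependent_row_of_submatrix_eq_one hB) i)) j
  rw [plucker_eq_mk (rowGr B s hB)
    (Module.Basis.span (linearIndependent_row_of_submatrix_eq_one hB))]
  congr 1
  rw [h]

theorem exists_eq_rowGr (W : Gr K e d) (w : Module.Basis (Fin e) K W.1) (s : Fin e ↪o Fin d)
    (hs : maximalMinors (basisMatrix w) s ≠ 0) :
    ∃ (B : Matrix (Fin e) (Fin d) K) (hB : B.submatrix id s = 1), W = rowGr B s hB := by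
  set A := basisMatrix w with hA
  set N := A.submatrix id s with hN
  have hdet : IsUnit N.det := isUnit_iff_ne_zero.2 hs
  have hB : (N⁻¹ * A).submatrix id s = 1 := by
    rw [Matrix.submatrix_mul _ _ id id s Function.bijective_id, Matrix.submatrix_id_id, ← hN,
      Matrix.nonsing_inv_mul _ hdet]
  refine ⟨N⁻¹ * A, hB, ?_⟩
  refine Subtype.ext (Submodule.eq_of_le_of_finrank_eq ?_ ?_).symm
  · refine Submodule.span_le.2 ?_
    rintro _ ⟨i, rfl⟩
    have : (N⁻¹ * A).row i = ((∑ k, N⁻¹ i k • w k : W.1) : Fin d → K) := by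
      funext j
      simp [Matrix.mul_apply, hA, basisMatrix]
    rw [this]
    exact Submodule.coe_mem _
  · rw [(rowGr (N⁻¹ * A) s hB).2, W.2]

/-- Up to a sign, the minor formed by a sequence `c` of columns is a maximal minor with increasing
columns, or it vanishes because a column is repeated. The pair `q` consists of the factor, which is
a sign or zero, and of the increasing sequence of columns; if the factor is zero, the latter is
arbitrary, and `s` serves as a default. -/
theorem exists_sort_columns (s : Fin e ↪o Fin d) (c : Fin e → Fin d) :
    ∃ q : ℤ × (Fin e ↪o Fin d), (¬ Function.Injective c ∧ q.1 = 0) ∨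
      ∃ π : Equiv.Perm (Fin e), c = q.2 ∘ π ∧ q.1 = Equiv.Perm.sign π := by
  by_cases hc : Function.Injective c
  · have hmono : StrictMono (c ∘ Tuple.sort c) :=
      (Tuple.monotone_sort c).strictMono_of_injective (hc.comp (Tuple.sort c).injective)
    refine ⟨(((Equiv.Perm.sign (Tuple.sort c).symm : ℤˣ) : ℤ),
      OrderEmbedding.ofStrictMono _ hmono), Or.inr ⟨(Tuple.sort c).symm, ?_, rfl⟩⟩
    funext i
    simp
  · exact ⟨(0, s), Or.inl ⟨hc, rfl⟩⟩

theorem det_submatrix_eq_mul_maximalMinors {c : Fin e → Fin d} {q : ℤ × (Fin e ↪o Fin d)}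
    (h : (¬ Function.Injective c ∧ q.1 = 0) ∨
      ∃ π : Equiv.Perm (Fin e), c = q.2 ∘ π ∧ q.1 = Equiv.Perm.sign π)
    (B : Matrix (Fin e) (Fin d) K) :
    (B.submatrix id c).det = (q.1 : K) * maximalMinors B q.2 := by
  rcases h with ⟨hc, h0⟩ | ⟨π, hc, hπ⟩
  · rw [h0, Int.cast_zero, zero_mul]
    simp only [Function.Injective] at hc
    push Not at hc
    obtain ⟨i, j, hij, hne⟩ := hc
    exact Matrix.det_zero_of_column_eq hne fun k => by simp [hij]
  · rw [hπ, hc]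
    exact Matrix.det_permute' π (B.submatrix id q.2)

/-- A matrix which is the identity on the columns `s` can be recovered from its minors. -/
theorem det_submatrix_update {B : Matrix (Fin e) (Fin d) K} {s : Fin e ↪o Fin d}
    (hB : B.submatrix id s = 1) (i : Fin e) (j : Fin d) :
    (B.submatrix id (Function.update s i j)).det = B i j := by
  have h : B.submatrix id (Function.update s i j) =
      (1 : Matrix (Fin e) (Fin e) K).updateCol i (fun k => B k j) := by
    ext k l
    by_cases hl : l = i
    · subst hl
      simp
    · rw [Matrix.updateCol_ne hl, ← hB]
      simp [Function.update_of_ne hl]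
  rw [h, ← Matrix.cramer_apply, Matrix.cramer_one]
  rfl

end Single

variable {Q : Type*} [Fintype Q] {e d : Q → ℕ}

/-- The homogeneous coordinates of the point of the Segre variety given by a tuple of matrices:
the products of one maximal minor from each matrix. -/
def segreMinors {K : Type*} [Field K] (B : ∀ x, Matrix (Fin (e x)) (Fin (d x)) K) :
    (∀ x, Fin (e x) ↪o Fin (d x)) → K :=
  fun t => ∏ x, maximalMinors (B x) (t x)

open Classical in
/-- On the chart `T_s = 1` of the image of the product of Grassmannians, the matrices which
represent a point and are the identity on the columns `s x`, as polynomials in the coordinates. The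
entry `(i, j)` is the minor formed by the columns `s x` with the `i`-th of them replaced by `j`. -/
def chartMatrix (s : ∀ x, Fin (e x) ↪o Fin (d x)) (x : Q) :
    Matrix (Fin (e x)) (Fin (d x)) (MvPolynomial (∀ x, Fin (e x) ↪o Fin (d x)) ℤ) :=
  Matrix.of fun i j =>
    MvPolynomial.C (exists_sort_columns (s x) (Function.update (s x) i j)).choose.1 *
      MvPolynomial.X (Function.update s x
        (exists_sort_columns (s x) (Function.update (s x) i j)).choose.2)

section Field

variable {K : Type*} [Field K]

theorem map_chartMatrix_segreMinors (s : ∀ x, Fin (e x) ↪o Fin (d x))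
    (B : ∀ x, Matrix (Fin (e x)) (Fin (d x)) K) (hB : ∀ x, (B x).submatrix id (s x) = 1) (x : Q) :
    (chartMatrix s x).map (MvPolynomial.aeval (segreMinors B)) = B x := by
  classical
  ext i j
  have h := (exists_sort_columns (s x) (Function.update (s x) i j)).choose_spec
  set q := (exists_sort_columns (s x) (Function.update (s x) i j)).choose with hq
  have h1 : segreMinors B (Function.update s x q.2) = maximalMinors (B x) q.2 := by
    rw [segreMinors, Finset.prod_eq_single x]
    · rw [Function.update_self]
    · intro y _ hy
      rw [Function.update_of_ne hy, maximalMinors, hB y, Matrix.det_one]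
    · simp
  rw [← det_submatrix_update (hB x) i j, det_submatrix_eq_mul_maximalMinors h, ← h1]
  simp [chartMatrix, ← hq]

theorem segre_plucker_rowGr (s : ∀ x, Fin (e x) ↪o Fin (d x))
    (B : ∀ x, Matrix (Fin (e x)) (Fin (d x)) K) (hB : ∀ x, (B x).submatrix id (s x) = 1)
    (h0 : segreMinors B ≠ 0) :
    segre (fun x => plucker (rowGr (B x) (s x) (hB x))) =
      Projectivization.mk K (segreMinors B) h0 := by
  simp only [plucker_rowGr]
  exact segre_mk (fun x => maximalMinors (B x)) _ h0

theorem segreMinors_self (s : ∀ x, Fin (e x) ↪o Fin (d x))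
    (B : ∀ x, Matrix (Fin (e x)) (Fin (d x)) K) (hB : ∀ x, (B x).submatrix id (s x) = 1) :
    segreMinors B s = 1 := by
  simp [segreMinors, maximalMinors, hB]

/-- A point of the chart `T_s = 1` which lies on the image of the product of Grassmannians comes
from the row spaces of the matrices `chartMatrix s x`, and from no other tuple of subspaces. -/
theorem mem_image_segre_plucker_iff (E : Set (∀ x, Gr K (e x) (d x)))
    (s : ∀ x, Fin (e x) ↪o Fin (d x)) (v : (∀ x, Fin (e x) ↪o Fin (d x)) → K) (hv : v ≠ 0)
    (hvs : v s = 1) :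
    Projectivization.mk K v hv ∈ (fun W => segre fun x => plucker (W x)) '' E ↔
      ∃ hB : ∀ x, ((chartMatrix s x).map (MvPolynomial.aeval v)).submatrix id (s x) = 1,
        segreMinors (fun x => (chartMatrix s x).map (MvPolynomial.aeval v)) = v ∧
          (fun x => rowGr ((chartMatrix s x).map (MvPolynomial.aeval v)) (s x) (hB x)) ∈ E := by
  constructor
  · rintro ⟨W, hW, hWv⟩
    let w := fun x => Module.finBasisOfFinrankEq K (W x).1 (W x).2
    have h0 : (segreMinors fun x => basisMatrix (w x)) ≠ 0 := by
      have h : ∀ x, ∃ i, maximalMinors (basisMatrix (w x)) i ≠ 0 := fun x =>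
        Function.ne_iff.1 (maximalMinors_basisMatrix_ne_zero (w x))
      choose t ht using h
      exact Function.ne_iff.2 ⟨t, Finset.prod_ne_zero_iff.2 fun x _ => ht x⟩
    have h1 : segre (fun x => plucker (W x)) = Projectivization.mk K _ h0 :=
      segre_mk (fun x => maximalMinors (basisMatrix (w x))) _ h0
    dsimp only at hWv
    obtain ⟨a, ha⟩ := (Projectivization.mk_eq_mk_iff' K _ _ hv h0).1 (hWv.symm.trans h1)
    have h2 : ∀ x, maximalMinors (basisMatrix (w x)) (s x) ≠ 0 := by
      intro x hx
      have h3 : segreMinors (fun x => basisMatrix (w x)) s = 0 :=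
        Finset.prod_eq_zero (Finset.mem_univ x) hx
      have h4 := congrFun ha s
      rw [Pi.smul_apply, h3, smul_zero, hvs] at h4
      exact zero_ne_one h4
    choose B hB hWB using fun x => exists_eq_rowGr (W x) (w x) (s x) (h2 x)
    have h5 : segreMinors B ≠ 0 := fun h => by
      have := segreMinors_self s B hB
      rw [h] at this
      exact zero_ne_one this
    have h6 : segreMinors B = v := by
      have h7 := segre_plucker_rowGr s B hB h5
      simp only [← hWB] at h7
      obtain ⟨c, hc⟩ := (Projectivization.mk_eq_mk_iff' K _ _ h5 hv).1 (h7.symm.trans hWv)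
      have h8 := congrFun hc s
      rw [Pi.smul_apply, hvs, segreMinors_self s B hB, smul_eq_mul, mul_one] at h8
      rw [← hc, h8, one_smul]
    have h9 : (fun x => (chartMatrix s x).map (MvPolynomial.aeval v)) = B := by
      funext x
      rw [← h6, map_chartMatrix_segreMinors s B hB x]
    have h10 : ∀ x, (chartMatrix s x).map (MvPolynomial.aeval v) = B x := congrFun h9
    refine ⟨fun x => by rw [h10, hB x], by rw [h9, h6], ?_⟩
    convert hW using 2 with x
    rw [hWB x]
    congr 1
    exact h10 x
  · rintro ⟨hB, hBv, hE⟩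
    refine ⟨_, hE, ?_⟩
    dsimp only
    rw [segre_plucker_rowGr s _ hB (by rw [hBv]; exact hv)]
    congr 1

end Field

open Classical in
/-- The points of a chart which lie on the image of the product of Grassmannians form a closed
set. -/
theorem exists_chart_equations (s : ∀ x, Fin (e x) ↪o Fin (d x)) :
    ∃ F : Finset (MvPolynomial (∀ x, Fin (e x) ↪o Fin (d x)) ℤ), ∀ (K : Type*) [Field K]
      (v : (∀ x, Fin (e x) ↪o Fin (d x)) → K), (∀ f ∈ F, MvPolynomial.aeval v f = 0) ↔
        (∀ x, ((chartMatrix s x).map (MvPolynomial.aeval v)).submatrix id (s x) = 1) ∧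
          segreMinors (fun x => (chartMatrix s x).map (MvPolynomial.aeval v)) = v := by
  have : Fintype (∀ x, Fin (e x) ↪o Fin (d x)) := Fintype.ofFinite _
  refine ⟨(Finset.univ.image fun t : Σ x, Fin (e x) × Fin (e x) =>
      chartMatrix s t.1 t.2.1 (s t.1 t.2.2) - if t.2.1 = t.2.2 then 1 else 0) ∪
    Finset.univ.image fun t : ∀ x, Fin (e x) ↪o Fin (d x) =>
      (∏ x, ((chartMatrix s x).submatrix id (t x)).det) - MvPolynomial.X t, fun K _ v => ?_⟩
  simp only [Finset.mem_union, or_imp, forall_and, Finset.mem_image, Finset.mem_univ, true_and,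
    forall_exists_index, forall_apply_eq_imp_iff]
  refine and_congr ?_ ?_
  · constructor
    · intro h x
      ext i j
      have := h ⟨x, i, j⟩
      rw [map_sub, sub_eq_zero] at this
      rw [Matrix.submatrix_apply, Matrix.map_apply, id, this, Matrix.one_apply]
      split_ifs <;> simp
    · rintro h ⟨x, i, j⟩
      have := congrFun (congrFun (h x) i) j
      rw [Matrix.submatrix_apply, Matrix.map_apply, id, Matrix.one_apply] at this
      rw [map_sub, sub_eq_zero, this]
      dsimp only
      split_ifs <;> simp
  · rw [funext_iff]
    refine forall_congr' fun t => ?_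
    rw [map_sub, sub_eq_zero, map_prod, MvPolynomial.aeval_X]
    refine Eq.congr_left (Finset.prod_congr rfl fun x _ => ?_)
    rw [AlgHom.map_det]
    rfl

end GrassmannCharts

/-! ### Intertwining matrices -/

section Intertwiners

/-- The matrix with the given entries. -/
abbrev uncurried {K I J : Type*} (z : I × J → K) : Matrix I J K := Matrix.of fun i j => z (i, j)

theorem sum_mul_mul_eq_mul_mul {P I J I' J' : Type*} [CommRing P] [Fintype I] [Fintype J]
    (A : Matrix I' I P) (C : Matrix J J' P) (z : I × J → P) (i : I') (j : J') :
    ∑ p : I × J, A i p.1 * C p.2 j * z p = (A * uncurried z * C) i j := by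
  simp only [Matrix.mul_apply, Finset.sum_mul, Fintype.sum_prod_type, uncurried, Matrix.of_apply]
  rw [Finset.sum_comm]
  exact Finset.sum_congr rfl fun _ _ => Finset.sum_congr rfl fun _ _ => by ring

theorem map_one_entry {P P' I : Type*} [CommRing P] [CommRing P'] [DecidableEq I] (φ : P →+* P')
    (i j : I) : φ ((1 : Matrix I I P) i j) = (1 : Matrix I I P') i j := by
  rw [Matrix.one_apply, Matrix.one_apply]
  split_ifs <;> simp

variable {G J J₁ J₂ P : Type*} [CommRing P]

/-- The linear system `ρ t * B * Φ = B * Φ * ρ₁ t` for the entries of `Φ`. If the columns of `B`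
form a basis of a subrepresentation of `ρ`, its solutions are the homomorphisms from `ρ₁` to this
subrepresentation. -/
def subSystem [Fintype J] [DecidableEq J₁] (ρ : G → Matrix J J P) (ρ₁ : G → Matrix J₁ J₁ P)
    (B : Matrix J J₁ P) : Matrix (G × J × J₁) (J₁ × J₁) P :=
  Matrix.of fun e p => (ρ e.1 * B) e.2.1 p.1 * (1 : Matrix J₁ J₁ P) p.2 e.2.2 -
    B e.2.1 p.1 * ρ₁ e.1 p.2 e.2.2

theorem subSystem_mulVec_eq_zero_iff [Fintype J] [Fintype J₁] [DecidableEq J₁]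
    (ρ : G → Matrix J J P) (ρ₁ : G → Matrix J₁ J₁ P) (B : Matrix J J₁ P) (z : J₁ × J₁ → P) :
    (subSystem ρ ρ₁ B).mulVec z = 0 ↔ ∀ t, ρ t * B * uncurried z = B * uncurried z * ρ₁ t := by
  have h : ∀ t i j, (subSystem ρ ρ₁ B).mulVec z (t, i, j) =
      (ρ t * B * uncurried z) i j - (B * uncurried z * ρ₁ t) i j := by
    intro t i j
    rw [← sum_mul_mul_eq_mul_mul, ← Matrix.mul_one (ρ t * B * uncurried z),
      ← sum_mul_mul_eq_mul_mul, ← Finset.sum_sub_distrib]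
    exact Finset.sum_congr rfl fun p _ => sub_mul _ _ _
  constructor
  · intro hz t
    ext i j
    rw [← sub_eq_zero, ← h, hz]
    rfl
  · intro hz
    funext ⟨t, i, j⟩
    rw [h, hz, sub_self]
    rfl

theorem map_subSystem [Fintype J] {P' : Type*} [CommRing P'] [DecidableEq J₁] (φ : P →+* P')
    (ρ : G → Matrix J J P) (ρ₁ : G → Matrix J₁ J₁ P) (B : Matrix J J₁ P) :
    (subSystem ρ ρ₁ B).map φ =
      subSystem (fun t => (ρ t).map φ) (fun t => (ρ₁ t).map φ) (B.map φ) := by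
  ext e p
  simp only [subSystem, Matrix.of_apply, Matrix.map_apply, map_sub, map_mul, Matrix.mul_apply,
    map_sum, map_one_entry]

/-- The linear system `Θ * ρ t = ρ₂ t * Θ`, `Θ * B = 0` for the entries of `Θ`. If the columns of
`B` form a basis of a subrepresentation of `ρ`, its solutions are the homomorphisms from the
quotient by this subrepresentation to `ρ₂`. -/
def quotSystem [DecidableEq J] [DecidableEq J₂] (ρ : G → Matrix J J P) (ρ₂ : G → Matrix J₂ J₂ P)
    (B : Matrix J J₁ P) : Matrix ((G × J₂ × J) ⊕ (J₂ × J₁)) (J₂ × J) P :=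
  Matrix.of fun e p => match e with
    | .inl e => (1 : Matrix J₂ J₂ P) e.2.1 p.1 * ρ e.1 p.2 e.2.2 -
        ρ₂ e.1 e.2.1 p.1 * (1 : Matrix J J P) p.2 e.2.2
    | .inr e => (1 : Matrix J₂ J₂ P) e.1 p.1 * B p.2 e.2

theorem quotSystem_mulVec_eq_zero_iff [Fintype J] [Fintype J₂] [DecidableEq J] [DecidableEq J₂]
    (ρ : G → Matrix J J P) (ρ₂ : G → Matrix J₂ J₂ P) (B : Matrix J J₁ P) (z : J₂ × J → P) :
    (quotSystem ρ ρ₂ B).mulVec z = 0 ↔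
      (∀ t, uncurried z * ρ t = ρ₂ t * uncurried z) ∧ uncurried z * B = 0 := by
  have h : ∀ t i j, (quotSystem ρ ρ₂ B).mulVec z (.inl (t, i, j)) =
      (uncurried z * ρ t) i j - (ρ₂ t * uncurried z) i j := by
    intro t i j
    rw [← Matrix.mul_one (ρ₂ t * uncurried z), ← sum_mul_mul_eq_mul_mul,
      ← Matrix.one_mul (uncurried z * ρ t), ← Matrix.mul_assoc, ← sum_mul_mul_eq_mul_mul,
      ← Finset.sum_sub_distrib]
    exact Finset.sum_congr rfl fun p _ => sub_mul _ _ _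
  have h' : ∀ i j, (quotSystem ρ ρ₂ B).mulVec z (.inr (i, j)) = (uncurried z * B) i j := by
    intro i j
    rw [← Matrix.one_mul (uncurried z * B), ← Matrix.mul_assoc, ← sum_mul_mul_eq_mul_mul]
    rfl
  constructor
  · refine fun hz => ⟨fun t => ?_, ?_⟩
    · ext i j
      rw [← sub_eq_zero, ← h, hz]
      rfl
    · ext i j
      rw [← h', hz]
      rfl
  · rintro ⟨hz, hz'⟩
    funext e
    rcases e with ⟨t, i, j⟩ | ⟨i, j⟩
    · rw [h, hz, sub_self]
      rfl
    · rw [h', hz']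
      rfl

theorem map_quotSystem {P' : Type*} [CommRing P'] [DecidableEq J] [DecidableEq J₂] (φ : P →+* P')
    (ρ : G → Matrix J J P) (ρ₂ : G → Matrix J₂ J₂ P) (B : Matrix J J₁ P) :
    (quotSystem ρ ρ₂ B).map φ =
      quotSystem (fun t => (ρ t).map φ) (fun t => (ρ₂ t).map φ) (B.map φ) := by
  ext e p
  rcases e with e | e <;>
    simp only [quotSystem, Matrix.of_apply, Matrix.map_apply, map_sub, map_mul,
      map_one_entry]

variable {K : Type*} [Field K]

/-- Two linear systems whose spaces of solutions are isomorphic have the same corank. -/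
theorem rank_add_card_eq_of_ker_eq_map {ε ε' κ κ' : Type*} [Fintype κ] [Fintype κ']
    (A : Matrix ε κ K) (A' : Matrix ε' κ' K) (f : (κ → K) →ₗ[K] (κ' → K))
    (hf : Function.Injective f)
    (h : ∀ z', A'.mulVec z' = 0 ↔ ∃ z, A.mulVec z = 0 ∧ f z = z') :
    A'.rank + Fintype.card κ = A.rank + Fintype.card κ' := by
  have h1 : LinearMap.ker A'.mulVecLin = (LinearMap.ker A.mulVecLin).map f := by
    ext z'
    exact h z'
  have h2 := (Submodule.equivMapOfInjective f hf (LinearMap.ker A.mulVecLin)).finrank_eq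
  rw [← h1] at h2
  have h3 := A.mulVecLin.finrank_range_add_finrank_ker
  have h4 := A'.mulVecLin.finrank_range_add_finrank_ker
  rw [Module.finrank_fintype_fun_eq_card] at h3 h4
  unfold Matrix.rank
  omega

/-- If there is an isomorphism `Φ₀` from `ρ₁` to the subrepresentation, then all homomorphisms are
the composites of `Φ₀` with the endomorphisms of `ρ₁`, and the two systems, which have the same
number of unknowns, have the same rank. -/
theorem rank_subSystem [Fintype J] [Fintype J₁] [DecidableEq J₁] (ρ : G → Matrix J J K)
    (ρ₁ : G → Matrix J₁ J₁ K)
    (B : Matrix J J₁ K) (Bl : Matrix J₁ J K) (hB : Bl * B = 1) (Φ₀ : Matrix J₁ J₁ K)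
    (hdet : IsUnit Φ₀.det) (hΦ₀ : ∀ t, ρ t * B * Φ₀ = B * Φ₀ * ρ₁ t) :
    (subSystem ρ ρ₁ B).rank = (subSystem ρ₁ ρ₁ 1).rank := by
  have key : ∀ X : Matrix J₁ J₁ K, Φ₀⁻¹ * (Bl * (B * (Φ₀ * X))) = X := fun X => by
    rw [← Matrix.mul_assoc Bl, hB, Matrix.one_mul, Matrix.nonsing_inv_mul_cancel_left _ _ hdet]
  let f : (J₁ × J₁ → K) →ₗ[K] (J₁ × J₁ → K) :=
    { toFun := fun z p => (Φ₀ * uncurried z) p.1 p.2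
      map_add' := fun z w => by
        funext p
        simp [Matrix.mul_apply, mul_add, Finset.sum_add_distrib]
      map_smul' := fun c z => by
        funext p
        simp [Matrix.mul_apply, Finset.mul_sum, mul_left_comm] }
  have hf : ∀ z, uncurried (f z) = Φ₀ * uncurried z := fun z => rfl
  have hinj : Function.Injective f := by
    intro z w hzw
    have h1 : uncurried z = uncurried w := by
      rw [← key (uncurried z), ← key (uncurried w), ← hf, ← hf, hzw]
    funext ⟨i, j⟩
    exact congrFun (congrFun h1 i) j
  have := rank_add_card_eq_of_ker_eq_map (subSystem ρ₁ ρ₁ 1) (subSystem ρ ρ₁ B) f hinj ?_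
  · omega
  · intro z'
    simp only [subSystem_mulVec_eq_zero_iff, Matrix.mul_one, Matrix.one_mul]
    constructor
    · intro hz'
      refine ⟨fun p => (Φ₀⁻¹ * uncurried z') p.1 p.2, fun t => ?_, ?_⟩
      · have h1 : uncurried (fun p : J₁ × J₁ => (Φ₀⁻¹ * uncurried z') p.1 p.2) =
          Φ₀⁻¹ * uncurried z' := rfl
        have h2 : Φ₀ * (Φ₀⁻¹ * uncurried z') = uncurried z' :=
          Matrix.mul_nonsing_inv_cancel_left _ _ hdet
        rw [h1, ← key (ρ₁ t * _), ← key (Φ₀⁻¹ * _ * ρ₁ t)]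
        congr 2
        rw [← Matrix.mul_assoc Φ₀ (ρ₁ t), ← Matrix.mul_assoc B, ← Matrix.mul_assoc B, ← hΦ₀,
          Matrix.mul_assoc, h2, ← Matrix.mul_assoc Φ₀, h2, ← Matrix.mul_assoc]
        exact hz' t
      · have h1 : uncurried (f fun p => (Φ₀⁻¹ * uncurried z') p.1 p.2) = uncurried z' :=
          Matrix.mul_nonsing_inv_cancel_left _ _ hdet
        funext ⟨i, j⟩
        exact congrFun (congrFun h1 i) j
    · rintro ⟨z, hz, rfl⟩ t
      rw [hf, ← Matrix.mul_assoc, hΦ₀, Matrix.mul_assoc, hz, ← Matrix.mul_assoc, ← Matrix.mul_assoc]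

/-- If `Θ₀` induces an isomorphism from the quotient to `ρ₂`, then all homomorphisms are the
composites of `Θ₀` with the endomorphisms of `ρ₂`. -/
theorem rank_quotSystem [Fintype J] [Fintype J₁] [Fintype J₂] [DecidableEq J] [DecidableEq J₂]
    (ρ : G → Matrix J J K) (ρ₂ : G → Matrix J₂ J₂ K) (B : Matrix J J₁ K)
    (Θ₀ : Matrix J₂ J K) (H : Matrix J J₂ K) (hH : Θ₀ * H = 1) (hΘ₀ : ∀ t, Θ₀ * ρ t = ρ₂ t * Θ₀)
    (hB : Θ₀ * B = 0)
    (hker : ∀ w : J → K, Θ₀.mulVec w = 0 → ∃ y, B.mulVec y = w) :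
    (quotSystem ρ ρ₂ B).rank + Fintype.card (J₂ × J₂) =
      (subSystem ρ₂ ρ₂ 1).rank + Fintype.card (J₂ × J) := by
  let f : (J₂ × J₂ → K) →ₗ[K] (J₂ × J → K) :=
    { toFun := fun z p => (uncurried z * Θ₀) p.1 p.2
      map_add' := fun z w => by
        funext p
        simp [Matrix.mul_apply, add_mul, Finset.sum_add_distrib]
      map_smul' := fun c z => by
        funext p
        simp [Matrix.mul_apply, Finset.mul_sum, mul_assoc] }
  have hf : ∀ z, uncurried (f z) = uncurried z * Θ₀ := fun z => rfl
  have key : ∀ X : Matrix J₂ J₂ K, X * Θ₀ * H = X := fun X => by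
    rw [Matrix.mul_assoc, hH, Matrix.mul_one]
  have hinj : Function.Injective f := by
    intro z w hzw
    have h1 : uncurried z = uncurried w := by
      rw [← key (uncurried z), ← key (uncurried w), ← hf, ← hf, hzw]
    funext ⟨i, j⟩
    exact congrFun (congrFun h1 i) j
  refine rank_add_card_eq_of_ker_eq_map (subSystem ρ₂ ρ₂ 1) (quotSystem ρ ρ₂ B) f hinj ?_
  intro z'
  simp only [subSystem_mulVec_eq_zero_iff, quotSystem_mulVec_eq_zero_iff, Matrix.mul_one,
    Matrix.one_mul]
  constructor
  · rintro ⟨h1, h2⟩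
    -- a matrix that vanishes on the image of `B` factors through `Θ₀`
    have h3 : uncurried z' * (1 - H * Θ₀) = 0 := by
      refine Matrix.ext_of_mulVec_single fun j => ?_
      obtain ⟨y, hy⟩ := hker ((1 - H * Θ₀).mulVec (Pi.single j 1)) (by
        rw [Matrix.mulVec_mulVec, Matrix.mul_sub, Matrix.mul_one, ← Matrix.mul_assoc, hH,
          Matrix.one_mul, sub_self, Matrix.zero_mulVec])
      rw [← Matrix.mulVec_mulVec, ← hy, Matrix.mulVec_mulVec, h2, Matrix.zero_mulVec,
        Matrix.zero_mulVec]
    rw [Matrix.mul_sub, Matrix.mul_one, sub_eq_zero, ← Matrix.mul_assoc] at h3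
    refine ⟨fun p => (uncurried z' * H) p.1 p.2, fun t => ?_, ?_⟩
    · have h4 : uncurried (fun p : J₂ × J₂ => (uncurried z' * H) p.1 p.2) = uncurried z' * H := rfl
      rw [h4, ← key (ρ₂ t * _), ← key (uncurried z' * H * ρ₂ t)]
      congr 1
      rw [Matrix.mul_assoc (ρ₂ t), ← h3, Matrix.mul_assoc _ (ρ₂ t), ← hΘ₀, ← Matrix.mul_assoc, ← h3,
        h1]
    · have h4 : uncurried (f fun p => (uncurried z' * H) p.1 p.2) = uncurried z' := h3.symm
      funext ⟨i, j⟩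
      exact congrFun (congrFun h4 i) j
  · rintro ⟨z, hz, rfl⟩
    refine ⟨fun t => ?_, ?_⟩
    · rw [hf, Matrix.mul_assoc, hΘ₀, ← Matrix.mul_assoc, ← hz, Matrix.mul_assoc]
    · rw [hf, Matrix.mul_assoc, hB, Matrix.mul_zero]

end Intertwiners

/-! ### Specialized modules in coordinates -/

section Specialized

variable {A N N' G I I' : Type*} [Ring A] [AddCommGroup N] [Module Aᵐᵒᵖ N]
  [AddCommGroup N'] [Module Aᵐᵒᵖ N'] [Fintype I] [DecidableEq I] [Fintype I'] [DecidableEq I']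

/-- The matrix by which `a` acts on the right module `N` with basis `ν`. -/
def actionMatrix (ν : Module.Basis I ℤ N) (a : A) : Matrix I I ℤ :=
  LinearMap.toMatrix ν ν (rightActionHom A N (MulOpposite.op a))

variable (K : Type*) [Field K]

theorem op_one_tmul_smul (a : A) (z : K ⊗[ℤ] N) :
    MulOpposite.op ((1 : K) ⊗ₜ[ℤ] a) • z =
      (rightActionHom A N (MulOpposite.op a)).baseChange K z := by
  induction z with
  | zero => rw [smul_zero, map_zero]
  | add z w hz hw => rw [smul_add, map_add, hz, hw]
  | tmul c n =>
    rw [op_tmul_smul_tmul, mul_one, LinearMap.baseChange_tmul]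
    rfl

/-- The `K`-basis `1 ⊗ ν i` of `K ⊗ N`. -/
abbrev basisOver (ν : Module.Basis I ℤ N) : Module.Basis I K (K ⊗[ℤ] N) :=
  Algebra.TensorProduct.basis K ν

/-- The matrix by which `1 ⊗ a` acts on `K ⊗ N`. -/
abbrev actionMatrixOver (ν : Module.Basis I ℤ N) (a : A) : Matrix I I K :=
  (actionMatrix ν a).map (Int.castRingHom K)

theorem toMatrix_baseChange_rightActionHom (ν : Module.Basis I ℤ N) (a : A) :
    LinearMap.toMatrix (basisOver K ν) (basisOver K ν)
      ((rightActionHom A N (MulOpposite.op a)).baseChange K) = actionMatrixOver K ν a := by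
  rw [LinearMap.toMatrix_baseChange]
  rfl

variable {K}

/-- A linear map between scalar extensions commutes with the action of `a` if and only if its matrix
intertwines the matrices of the action. -/
theorem commutes_iff_toMatrix_mul_eq (ν : Module.Basis I ℤ N) (ν' : Module.Basis I' ℤ N') (a : A)
    (f : K ⊗[ℤ] N →ₗ[K] K ⊗[ℤ] N') :
    (∀ z, f (MulOpposite.op ((1 : K) ⊗ₜ[ℤ] a) • z) = MulOpposite.op ((1 : K) ⊗ₜ[ℤ] a) • f z) ↔
      LinearMap.toMatrix (basisOver K ν) (basisOver K ν') f * actionMatrixOver K ν a =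
        actionMatrixOver K ν' a * LinearMap.toMatrix (basisOver K ν) (basisOver K ν') f := by
  rw [← toMatrix_baseChange_rightActionHom, ← toMatrix_baseChange_rightActionHom,
    ← LinearMap.toMatrix_comp, ← LinearMap.toMatrix_comp, EmbeddingLike.apply_eq_iff_eq,
    LinearMap.ext_iff]
  simp only [op_one_tmul_smul, LinearMap.comp_apply]

theorem span_op_one_tmul_eq_top (α : G → A) (hα : Submodule.span ℤ (Set.range α) = ⊤) :
    Submodule.span K (Set.range fun t => MulOpposite.op ((1 : K) ⊗ₜ[ℤ] α t)) = ⊤ := by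
  rw [eq_top_iff]
  rintro x -
  induction x using MulOpposite.rec' with
  | _ x =>
    induction x with
    | zero => exact Submodule.zero_mem _
    | add x y hx hy => exact Submodule.add_mem _ hx hy
    | tmul c a =>
      have h1 : MulOpposite.op (c ⊗ₜ[ℤ] a) = c • MulOpposite.op ((1 : K) ⊗ₜ[ℤ] a) := by
        rw [← MulOpposite.op_smul, TensorProduct.smul_tmul', smul_eq_mul, mul_one]
      rw [h1]
      refine Submodule.smul_mem _ _ ?_
      clear h1
      have ha : a ∈ Submodule.span ℤ (Set.range α) := hα ▸ Submodule.mem_top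
      induction ha using Submodule.span_induction with
      | mem a ha =>
        obtain ⟨t, rfl⟩ := ha
        exact Submodule.subset_span ⟨t, rfl⟩
      | zero =>
        rw [TensorProduct.tmul_zero]
        exact Submodule.zero_mem _
      | add a b _ _ ha hb =>
        rw [TensorProduct.tmul_add]
        exact Submodule.add_mem _ ha hb
      | smul n a _ ha =>
        rw [TensorProduct.tmul_smul, MulOpposite.op_smul]
        exact zsmul_mem ha n

/-- A `K`-linear map between modules over `K ⊗ A` which commutes with generators of `A` is
`K ⊗ A`-linear. -/
def linearMapOfCommutes {X Y : Type*} [AddCommGroup X] [AddCommGroup Y]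
    [Module (K ⊗[ℤ] A)ᵐᵒᵖ X] [Module K X] [IsScalarTower K (K ⊗[ℤ] A)ᵐᵒᵖ X]
    [Module (K ⊗[ℤ] A)ᵐᵒᵖ Y] [Module K Y] [IsScalarTower K (K ⊗[ℤ] A)ᵐᵒᵖ Y]
    (α : G → A) (hα : Submodule.span ℤ (Set.range α) = ⊤) (f : X →ₗ[K] Y)
    (hf : ∀ t z, f (MulOpposite.op ((1 : K) ⊗ₜ[ℤ] α t) • z) =
      MulOpposite.op ((1 : K) ⊗ₜ[ℤ] α t) • f z) : X →ₗ[(K ⊗[ℤ] A)ᵐᵒᵖ] Y :=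
  { f with
    map_smul' := fun r z => by
      have hr : r ∈ Submodule.span K (Set.range fun t => MulOpposite.op ((1 : K) ⊗ₜ[ℤ] α t)) :=
        span_op_one_tmul_eq_top (K := K) α hα ▸ Submodule.mem_top
      change f (r • z) = r • f z
      induction hr using Submodule.span_induction with
      | mem r hr =>
        obtain ⟨t, rfl⟩ := hr
        exact hf t z
      | zero =>
        rw [zero_smul (K ⊗[ℤ] A)ᵐᵒᵖ z, zero_smul (K ⊗[ℤ] A)ᵐᵒᵖ (f z), map_zero]
      | add r s _ _ hr hs => rw [add_smul, map_add, hr, hs, add_smul]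
      | smul c r _ hr => rw [smul_assoc, map_smul, hr, smul_assoc] }

end Specialized

/-! ### Submodules and quotients given by a matrix of columns -/

section Submodules

variable {K A M N G J I κ : Type*} [Field K] [Ring A] [AddCommGroup M] [Module Aᵐᵒᵖ M]
  [AddCommGroup N] [Module Aᵐᵒᵖ N] [Fintype J] [Fintype I] [DecidableEq I]

/-- The linear map from `K ^ I` to `K ⊗ M` whose matrix is `B`. -/
abbrev columnMap (μ : Module.Basis J ℤ M) (B : Matrix J I K) : (I → K) →ₗ[K] K ⊗[ℤ] M :=
  Matrix.toLin (Pi.basisFun K I) (basisOver K μ) B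

variable [Fintype κ]

/-- If the determinant of the matrix of a generic homomorphism `K ⊗ N → K ⊗ M` with values in the
column space of `B` does not vanish, then this column space is the sum of the images of such
homomorphisms, hence a submodule, and it is isomorphic to `K ⊗ N`. -/
theorem exists_submodule_equiv_of_genericDet_ne_zero [DecidableEq J] (α : G → A)
    (hα : Submodule.span ℤ (Set.range α) = ⊤) (μ : Module.Basis J ℤ M) (ν : Module.Basis I ℤ N)
    (B : Matrix J I K) (hB : Function.Injective (columnMap μ B)) (Z : Matrix (I × I) κ K)
    (hZ : ∀ k t, actionMatrixOver K μ (α t) * B * uncurried (fun p => Z p k) =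
      B * uncurried (fun p => Z p k) * actionMatrixOver K ν (α t))
    (c : I → I) (hc : genericDet Z c ≠ 0) :
    ∃ U : Submodule (K ⊗[ℤ] A)ᵐᵒᵖ (K ⊗[ℤ] M),
      U.restrictScalars K = LinearMap.range (columnMap μ B) ∧
        Nonempty (U ≃ₗ[(K ⊗[ℤ] A)ᵐᵒᵖ] (K ⊗[ℤ] N)) := by
  let f : κ → (K ⊗[ℤ] N →ₗ[K] K ⊗[ℤ] M) := fun k =>
    Matrix.toLin (basisOver K ν) (basisOver K μ) (B * uncurried fun p => Z p k)
  have hf : ∀ k t z, f k (MulOpposite.op ((1 : K) ⊗ₜ[ℤ] α t) • z) =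
      MulOpposite.op ((1 : K) ⊗ₜ[ℤ] α t) • f k z := by
    intro k t
    rw [commutes_iff_toMatrix_mul_eq ν μ, LinearMap.toMatrix_toLin, ← Matrix.mul_assoc, hZ]
  have hfcomp : ∀ k, f k = columnMap μ B ∘ₗ Matrix.toLin (basisOver K ν) (Pi.basisFun K I)
      (uncurried fun p => Z p k) := fun k => Matrix.toLin_mul _ _ _ _ _
  have hfB : ∀ k i, f k (basisOver K ν i) =
      columnMap μ B (fun i' => Z (i', i) k) := by
    intro k i
    rw [hfcomp, LinearMap.comp_apply, Matrix.toLin_self]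
    congr 1
    funext i'
    simp [Finset.sum_apply, Pi.single_apply]
  let g : κ → (K ⊗[ℤ] N →ₗ[(K ⊗[ℤ] A)ᵐᵒᵖ] K ⊗[ℤ] M) := fun k =>
    linearMapOfCommutes α hα (f k) (hf k)
  let U : Submodule (K ⊗[ℤ] A)ᵐᵒᵖ (K ⊗[ℤ] M) := ⨆ k, LinearMap.range (g k)
  have hle : ∀ k z, f k z ∈ LinearMap.range (columnMap μ B) := by
    intro k z
    rw [hfcomp]
    exact ⟨_, rfl⟩
  have hU1 : U.restrictScalars K ≤ LinearMap.range (columnMap μ B) := by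
    intro u hu
    rw [Submodule.restrictScalars_mem] at hu
    induction hu using Submodule.iSup_induction' with
    | mem k u hu =>
      obtain ⟨z, rfl⟩ := hu
      exact hle k z
    | zero => exact Submodule.zero_mem _
    | add u u' _ _ hu hu' => exact Submodule.add_mem _ hu hu'
  have hgU : ∀ k z, g k z ∈ U := fun k z =>
    Submodule.mem_iSup_of_mem k (LinearMap.mem_range_self (g k) z)
  -- A proper subspace would be annihilated by a linear form, which would be a relation between the
  -- rows of the generic matrix.
  have hV : (U.restrictScalars K).comap (columnMap μ B) = ⊤ := by
    by_contra hne
    obtain ⟨l, hl, hle⟩ := Submodule.exists_le_ker_of_lt_top _ (lt_top_iff_ne_top.2 hne)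
    have h1 : ∀ k i, ∑ i', l (Pi.single i' 1) * Z (i', i) k = 0 := by
      intro k i
      have h2 : (fun i' => Z (i', i) k) ∈ (U.restrictScalars K).comap (columnMap μ B) := by
        rw [Submodule.mem_comap, ← hfB, Submodule.restrictScalars_mem]
        exact hgU k _
      have h3 : l (fun i' => Z (i', i) k) = 0 := hle h2
      rw [LinearMap.pi_apply_eq_sum_univ] at h3
      rw [← h3]
      refine Finset.sum_congr rfl fun i' _ => ?_
      rw [smul_eq_mul, mul_comm]
      congr 2
      funext j
      simp [Pi.single_apply, eq_comm]
    refine hc (Matrix.exists_vecMul_eq_zero_iff.1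
      ⟨fun i' => MvPolynomial.C (l (Pi.single i' 1)), ?_, ?_⟩)
    · intro h0
      refine hl (LinearMap.pi_ext' fun i' => LinearMap.ext_ring ?_)
      have := congrFun h0 i'
      simpa using this
    · funext j
      have : ∑ k, MvPolynomial.X k *
          MvPolynomial.C (∑ i', l (Pi.single i' 1) * Z (i', c j) k) = 0 :=
        Finset.sum_eq_zero fun k _ => by rw [h1, map_zero, mul_zero]
      rw [Pi.zero_apply, ← this]
      simp only [Matrix.vecMul, dotProduct, Matrix.of_apply, Finset.mul_sum, map_sum, map_mul]
      rw [Finset.sum_comm]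
      exact Finset.sum_congr rfl fun _ _ => Finset.sum_congr rfl fun _ _ => by ring
  have hU : U.restrictScalars K = LinearMap.range (columnMap μ B) := by
    refine le_antisymm hU1 ?_
    rintro _ ⟨y, rfl⟩
    have : y ∈ (U.restrictScalars K).comap (columnMap μ B) := hV ▸ Submodule.mem_top
    exact this
  refine ⟨U, hU, ?_⟩
  let e : (I → K) ≃ₗ[K] U :=
    (LinearEquiv.ofInjective _ hB).trans (LinearEquiv.ofEq _ _ hU.symm)
  have he : ∀ y, ((e y : U) : K ⊗[ℤ] M) = columnMap μ B y := fun y => rfl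
  let γ : Module.Basis I K U := (Pi.basisFun K I).map e
  have : FiniteDimensional K U := γ.finiteDimensional_of_finite
  have : FiniteDimensional K (K ⊗[ℤ] N) := (basisOver K ν).finiteDimensional_of_finite
  have hfin : Module.finrank K (K ⊗[ℤ] N) = Module.finrank K U := by
    rw [Module.finrank_eq_card_basis (basisOver K ν), Module.finrank_eq_card_basis γ]
  have hrepr : ∀ k i j, γ.repr ((g k).codRestrict U (hgU k) (basisOver K ν (c j))) i =
      Z (i, c j) k := by
    intro k i j
    have h1 : (g k).codRestrict U (hgU k) (basisOver K ν (c j)) = e (fun i' => Z (i', c j) k) :=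
      Subtype.ext (hfB k (c j))
    rw [h1, Module.Basis.map_repr, LinearEquiv.trans_apply, LinearEquiv.symm_apply_apply,
      Pi.basisFun_repr]
  obtain ⟨e'⟩ := nonempty_equiv_of_det_generic_ne_zero (K := K) (R := (K ⊗[ℤ] A)ᵐᵒᵖ)
    (X := K ⊗[ℤ] N) (Y := U) hfin (fun i => basisOver K ν (c i)) γ
    (fun k => (g k).codRestrict U (hgU k)) (by
      simp only [hrepr]
      exact hc)
  exact ⟨e'.symm⟩

variable {L : Type*} [Fintype L] [DecidableEq L]

theorem columnMap_injective [DecidableEq J] (μ : Module.Basis J ℤ M) {B : Matrix J L K}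
    {B' : Matrix L J K} (h : B' * B = 1) : Function.Injective (columnMap μ B) := by
  have h1 : Matrix.toLin (basisOver K μ) (Pi.basisFun K L) B' ∘ₗ columnMap μ B = LinearMap.id := by
    rw [← Matrix.toLin_mul, h, Matrix.toLin_one]
  exact fun y z hyz => by
    rw [← LinearMap.id_apply (R := K) y, ← h1, LinearMap.comp_apply, hyz, ← LinearMap.comp_apply,
      h1, LinearMap.id_apply]

theorem finrank_quotient_of_range_columnMap (μ : Module.Basis J ℤ M) {B : Matrix J L K}
    (hB : Function.Injective (columnMap μ B)) (U : Submodule (K ⊗[ℤ] A)ᵐᵒᵖ (K ⊗[ℤ] M))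
    (hU : U.restrictScalars K = LinearMap.range (columnMap μ B)) :
    Module.finrank K ((K ⊗[ℤ] M) ⧸ U) + Fintype.card L = Fintype.card J := by
  have : FiniteDimensional K (K ⊗[ℤ] M) := (basisOver K μ).finiteDimensional_of_finite
  rw [← (Submodule.Quotient.restrictScalarsEquiv K U).finrank_eq,
    ← Module.finrank_eq_card_basis (basisOver K μ),
    ← Submodule.finrank_quotient_add_finrank (U.restrictScalars K), hU,
    LinearMap.finrank_range_of_inj hB, Module.finrank_fintype_fun_eq_card]

/-- If the determinant formed by some columns of the matrix of a generic homomorphism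
`K ⊗ M → K ⊗ N` which vanishes on `U` is not zero, then the quotient by `U` is isomorphic to
`K ⊗ N`. -/
theorem nonempty_quotient_equiv_of_genericDet_ne_zero [DecidableEq J] (α : G → A)
    (hα : Submodule.span ℤ (Set.range α) = ⊤) (μ : Module.Basis J ℤ M) (ν : Module.Basis I ℤ N)
    (B : Matrix J L K) (U : Submodule (K ⊗[ℤ] A)ᵐᵒᵖ (K ⊗[ℤ] M))
    (hU : U.restrictScalars K = LinearMap.range (columnMap μ B))
    (hfin : Module.finrank K ((K ⊗[ℤ] M) ⧸ U) = Fintype.card I) (Z : Matrix (I × J) κ K)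
    (hZ : ∀ k t, uncurried (fun p => Z p k) * actionMatrixOver K μ (α t) =
      actionMatrixOver K ν (α t) * uncurried (fun p => Z p k))
    (hZB : ∀ k, uncurried (fun p => Z p k) * B = 0) (c : I → J) (hc : genericDet Z c ≠ 0) :
    Nonempty (((K ⊗[ℤ] M) ⧸ U) ≃ₗ[(K ⊗[ℤ] A)ᵐᵒᵖ] (K ⊗[ℤ] N)) := by
  let f : κ → (K ⊗[ℤ] M →ₗ[K] K ⊗[ℤ] N) := fun k =>
    Matrix.toLin (basisOver K μ) (basisOver K ν) (uncurried fun p => Z p k)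
  have hf : ∀ k t z, f k (MulOpposite.op ((1 : K) ⊗ₜ[ℤ] α t) • z) =
      MulOpposite.op ((1 : K) ⊗ₜ[ℤ] α t) • f k z := by
    intro k t
    rw [commutes_iff_toMatrix_mul_eq μ ν, LinearMap.toMatrix_toLin, hZ]
  let g : κ → (K ⊗[ℤ] M →ₗ[(K ⊗[ℤ] A)ᵐᵒᵖ] K ⊗[ℤ] N) := fun k =>
    linearMapOfCommutes α hα (f k) (hf k)
  have hgU : ∀ k, U ≤ LinearMap.ker (g k) := by
    intro k u hu
    have h1 : u ∈ LinearMap.range (columnMap μ B) := by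
      rw [← hU]
      exact hu
    obtain ⟨y, rfl⟩ := h1
    have h2 : f k ∘ₗ columnMap μ B = 0 := by
      rw [← Matrix.toLin_mul, hZB, map_zero]
    exact LinearMap.congr_fun h2 y
  have : FiniteDimensional K (K ⊗[ℤ] M) := (basisOver K μ).finiteDimensional_of_finite
  have : FiniteDimensional K (K ⊗[ℤ] N) := (basisOver K ν).finiteDimensional_of_finite
  have : FiniteDimensional K ((K ⊗[ℤ] M) ⧸ U) :=
    (Submodule.Quotient.restrictScalarsEquiv K U).finiteDimensional
  have hrepr : ∀ k i j, (basisOver K ν).repr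
      (U.liftQ (g k) (hgU k) (U.mkQ (basisOver K μ (c j)))) i = Z (i, c j) k := by
    intro k i j
    have h1 : U.liftQ (g k) (hgU k) (U.mkQ (basisOver K μ (c j))) = f k (basisOver K μ (c j)) := rfl
    rw [h1, ← LinearMap.toMatrix_apply, LinearMap.toMatrix_toLin]
    rfl
  refine nonempty_equiv_of_det_generic_ne_zero (K := K) (R := (K ⊗[ℤ] A)ᵐᵒᵖ)
    (X := (K ⊗[ℤ] M) ⧸ U) (Y := K ⊗[ℤ] N)
    (hfin.trans (Module.finrank_eq_card_basis (basisOver K ν)).symm)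
    (fun j => U.mkQ (basisOver K μ (c j))) (basisOver K ν) (fun k => U.liftQ (g k) (hgU k)) ?_
  simp only [hrepr]
  exact hc

/-- The matrix of an isomorphism from `K ⊗ N` to the submodule `U`, with respect to the columns of
`B`, is an invertible solution of the linear system for homomorphisms. -/
theorem exists_intertwiner_of_equiv [DecidableEq J] (μ : Module.Basis J ℤ M)
    (ν : Module.Basis I ℤ N)
    (B : Matrix J I K) (hB : Function.Injective (columnMap μ B))
    (U : Submodule (K ⊗[ℤ] A)ᵐᵒᵖ (K ⊗[ℤ] M))
    (hU : U.restrictScalars K = LinearMap.range (columnMap μ B))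
    (e : U ≃ₗ[(K ⊗[ℤ] A)ᵐᵒᵖ] (K ⊗[ℤ] N)) :
    ∃ Φ : Matrix I I K, IsUnit Φ.det ∧
      ∀ a : A, actionMatrixOver K μ a * B * Φ = B * Φ * actionMatrixOver K ν a := by
  let e₀ : (I → K) ≃ₗ[K] U :=
    (LinearEquiv.ofInjective _ hB).trans (LinearEquiv.ofEq _ _ hU.symm)
  let h : K ⊗[ℤ] N ≃ₗ[K] (I → K) := (e.symm.restrictScalars K).trans e₀.symm
  let f : K ⊗[ℤ] N →ₗ[K] K ⊗[ℤ] M := (U.subtype ∘ₗ e.symm.toLinearMap).restrictScalars K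
  have hf : f = columnMap μ B ∘ₗ h.toLinearMap := by
    refine LinearMap.ext fun z => ?_
    have h1 : e₀ (h z) = e.symm z := e₀.apply_symm_apply _
    change ((e.symm z : U) : K ⊗[ℤ] M) = columnMap μ B (h z)
    rw [← h1]
    rfl
  refine ⟨LinearMap.toMatrix (basisOver K ν) (Pi.basisFun K I) h.toLinearMap,
    LinearEquiv.isUnit_det h _ _, fun a => ?_⟩
  have h2 : B * LinearMap.toMatrix (basisOver K ν) (Pi.basisFun K I) h.toLinearMap =
      LinearMap.toMatrix (basisOver K ν) (basisOver K μ) f := by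
    rw [hf, LinearMap.toMatrix_comp _ (Pi.basisFun K I), LinearMap.toMatrix_toLin]
  rw [Matrix.mul_assoc, h2, ← (commutes_iff_toMatrix_mul_eq ν μ a f).1]
  exact fun z => (U.subtype ∘ₗ e.symm.toLinearMap).map_smul _ z

/-- The matrix of the surjection from `K ⊗ M` to `K ⊗ N` with kernel `U`, together with the matrix
`H` of a linear right inverse. -/
theorem exists_intertwiner_of_quotient_equiv [DecidableEq J] (μ : Module.Basis J ℤ M)
    (ν : Module.Basis I ℤ N)
    (B : Matrix J L K) (U : Submodule (K ⊗[ℤ] A)ᵐᵒᵖ (K ⊗[ℤ] M))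
    (hU : U.restrictScalars K = LinearMap.range (columnMap μ B))
    (e : ((K ⊗[ℤ] M) ⧸ U) ≃ₗ[(K ⊗[ℤ] A)ᵐᵒᵖ] (K ⊗[ℤ] N)) :
    ∃ Θ : Matrix I J K, (∀ a : A, Θ * actionMatrixOver K μ a = actionMatrixOver K ν a * Θ) ∧
      Θ * B = 0 ∧ (∃ H : Matrix J I K, Θ * H = 1) ∧
      ∀ w : J → K, Θ.mulVec w = 0 → ∃ y, B.mulVec y = w := by
  let f : K ⊗[ℤ] M →ₗ[K] K ⊗[ℤ] N := (e.toLinearMap ∘ₗ U.mkQ).restrictScalars K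
  have hfU : ∀ z, f z = 0 ↔ z ∈ LinearMap.range (columnMap μ B) := by
    intro z
    rw [← hU, Submodule.restrictScalars_mem]
    change e (U.mkQ z) = 0 ↔ _
    rw [e.map_eq_zero_iff, Submodule.mkQ_apply, Submodule.Quotient.mk_eq_zero]
  have hsurj : LinearMap.range f = ⊤ :=
    LinearMap.range_eq_top.2 (e.surjective.comp (Submodule.mkQ_surjective U))
  obtain ⟨h, hh⟩ := f.exists_rightInverse_of_surjective hsurj
  refine ⟨LinearMap.toMatrix (basisOver K μ) (basisOver K ν) f, fun a => ?_, ?_, ?_, ?_⟩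
  · exact (commutes_iff_toMatrix_mul_eq μ ν a f).1
      fun z => (e.toLinearMap ∘ₗ U.mkQ).map_smul _ z
  · have h1 : f ∘ₗ columnMap μ B = 0 :=
      LinearMap.ext fun y => (hfU _).2 ⟨y, rfl⟩
    have h2 := congrArg (LinearMap.toMatrix (Pi.basisFun K L) (basisOver K ν)) h1
    rwa [LinearMap.toMatrix_comp _ (basisOver K μ), LinearMap.toMatrix_toLin, map_zero] at h2
  · refine ⟨LinearMap.toMatrix (basisOver K ν) (basisOver K μ) h, ?_⟩
    rw [← LinearMap.toMatrix_comp, hh, LinearMap.toMatrix_id]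
  · intro w hw
    have h1 : f ((basisOver K μ).equivFun.symm w) = 0 := by
      refine (basisOver K ν).equivFun.injective ?_
      have h2 := LinearMap.toMatrix_mulVec_repr (basisOver K μ) (basisOver K ν) f
        ((basisOver K μ).equivFun.symm w)
      rw [map_zero, Module.Basis.equivFun_apply, ← h2, ← Module.Basis.equivFun_apply,
        LinearEquiv.apply_symm_apply, hw]
    obtain ⟨y, hy⟩ := (hfU _).1 h1
    refine ⟨y, ?_⟩
    have h3 := congrArg (basisOver K μ).equivFun hy
    rw [LinearEquiv.apply_symm_apply] at h3
    rw [← h3, Module.Basis.equivFun_apply,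
      ← LinearMap.toMatrix_mulVec_repr (Pi.basisFun K L) (basisOver K μ), LinearMap.toMatrix_toLin]
    rfl

theorem exists_det_submatrix_ne_zero {Θ : Matrix I J K} {H : Matrix J I K} (h : Θ * H = 1) :
    ∃ c : I → J, (Θ.submatrix id c).det ≠ 0 := by
  have hr : Fintype.card I ≤ Θ.transpose.rank := by
    rw [Matrix.rank_transpose, ← Matrix.rank_one (R := K) (n := I), ← h]
    exact Matrix.rank_mul_le_left Θ H
  obtain ⟨C, hC⟩ := exists_linearIndependent_rows _ hr
  refine ⟨C ∘ Fintype.equivFin I, ?_⟩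
  have h1 : LinearIndependent K (Θ.submatrix id (C ∘ Fintype.equivFin I)).transpose.row :=
    hC.comp _ (Fintype.equivFin I).injective
  have h2 := Matrix.linearIndependent_rows_iff_isUnit.1 h1
  rw [Matrix.isUnit_iff_isUnit_det, Matrix.det_transpose] at h2
  exact h2.ne_zero

end Submodules

/-! ### Block matrices of row spaces -/

section Blocks

variable {V K : Type*} [Fintype V] [Field K]

theorem mem_span_row_iff {m : ℕ} {n : ℕ} (C : Matrix (Fin m) (Fin n) K) (c : Fin n → K) :
    c ∈ Submodule.span K (Set.range C.row) ↔ ∃ y, Matrix.vecMul y C = c := by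
  rw [Submodule.mem_span_range_iff_exists_fun]
  refine exists_congr fun y => ?_
  rw [Matrix.vecMul_eq_sum]
  rfl

open Classical in
/-- The matrix whose columns span the direct sum over the vertices of the row spaces of the
matrices `B x`. -/
abbrev blockColumns {P : Type*} [Zero P] {e d : V → ℕ} (B : ∀ x, Matrix (Fin (e x)) (Fin (d x)) P) :
    Matrix (Σ x, Fin (d x)) (Σ x, Fin (e x)) P :=
  (Matrix.blockDiagonal' B).transpose

theorem blockColumns_mulVec {e d : V → ℕ} (B : ∀ x, Matrix (Fin (e x)) (Fin (d x)) K)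
    (y : (Σ x, Fin (e x)) → K) (p : Σ x, Fin (d x)) :
    (blockColumns B).mulVec y p = Matrix.vecMul (fun i => y ⟨p.1, i⟩) (B p.1) p.2 := by
  classical
  obtain ⟨x, j⟩ := p
  rw [Matrix.mulVec, dotProduct, Fintype.sum_sigma, Finset.sum_eq_single x]
  · simp [Matrix.vecMul, dotProduct, mul_comm]
  · intro x' _ hx'
    refine Finset.sum_eq_zero fun i _ => ?_
    have h : blockColumns B ⟨x, j⟩ ⟨x', i⟩ = 0 := Matrix.blockDiagonal'_apply_ne B i j hx'
    rw [h, zero_mul]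
  · simp

open Classical in
theorem exists_mul_blockColumns_eq_one {e d : V → ℕ} (B : ∀ x, Matrix (Fin (e x)) (Fin (d x)) K)
    (s : ∀ x, Fin (e x) ↪o Fin (d x)) (hB : ∀ x, (B x).submatrix id (s x) = 1) :
    ∃ B' : Matrix (Σ x, Fin (e x)) (Σ x, Fin (d x)) K, B' * blockColumns B = 1 := by
  refine ⟨(Matrix.blockDiagonal' fun x => (1 : Matrix _ _ K).submatrix id (s x)).transpose, ?_⟩
  rw [← Matrix.transpose_mul, ← Matrix.blockDiagonal'_mul]
  have h1 : ∀ x, B x * (1 : Matrix (Fin (d x)) (Fin (d x)) K).submatrix id (s x) = 1 := by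
    intro x
    have h := Matrix.submatrix_mul (B x) 1 id id (s x) Function.bijective_id
    rw [Matrix.mul_one, hB x, Matrix.submatrix_id_id] at h
    exact h.symm
  simp only [h1]
  exact (congrArg _ Matrix.blockDiagonal'_one).trans Matrix.transpose_one

end Blocks

/-! ### The decomposition along the vertices -/

section Vertices

variable {Q : Type*} [Quiver Q] [Fintype Q] (I : Ideal (PathAlgebra ℤ Q)) [I.IsTwoSided]
  {N : Type*} [AddCommGroup N] [Module (PathAlgebra ℤ Q ⧸ I)ᵐᵒᵖ N]

/-- The class of the trivial path at `x` in the quotient of the path algebra. -/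
abbrev idemClass (x : Q) : PathAlgebra ℤ Q ⧸ I := Ideal.Quotient.mk I (PathAlgebra.idem ℤ x)

theorem idemClass_mul_self (x : Q) : idemClass I x * idemClass I x = idemClass I x := by
  rw [idemClass, ← map_mul]
  exact congrArg _ (PathAlgebra.ofPath_mul_ofPath_comp _ _)

theorem idemClass_mul_of_ne {x y : Q} (h : x ≠ y) : idemClass I x * idemClass I y = 0 := by
  rw [idemClass, ← map_mul]
  exact (congrArg _ (PathAlgebra.ofPath_mul_ofPath_of_ne _ _ h)).trans (map_zero _)

theorem sum_idemClass : ∑ x : Q, idemClass I x = 1 := by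
  rw [← map_sum, ← PathAlgebra.one_def, map_one]

theorem op_idemClass_smul_of_mem {x : Q} {n : N} (hn : n ∈ vertexPart I N x) :
    MulOpposite.op (idemClass I x) • n = n := by
  obtain ⟨n, rfl⟩ := hn
  change MulOpposite.op (idemClass I x) • MulOpposite.op (idemClass I x) • n = _
  rw [← mul_smul, ← MulOpposite.op_mul, idemClass_mul_self]
  rfl

theorem op_idemClass_smul_of_mem_of_ne {x y : Q} (h : x ≠ y) {n : N}
    (hn : n ∈ vertexPart I N x) : MulOpposite.op (idemClass I y) • n = 0 := by
  obtain ⟨n, rfl⟩ := hn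
  change MulOpposite.op (idemClass I y) • MulOpposite.op (idemClass I x) • n = _
  rw [← mul_smul, ← MulOpposite.op_mul, idemClass_mul_of_ne I h, MulOpposite.op_zero, zero_smul]

theorem isInternal_vertexPart [DecidableEq Q] : DirectSum.IsInternal (vertexPart I N) := by
  refine DirectSum.isInternal_submodule_of_iSupIndep_of_iSup_eq_top (fun x => ?_) ?_
  · rw [Submodule.disjoint_def]
    intro n hn hn'
    rw [← op_idemClass_smul_of_mem I hn]
    have h : ⨆ y, ⨆ (_ : y ≠ x), vertexPart I N y ≤
        LinearMap.ker (rightActionHom (PathAlgebra ℤ Q ⧸ I) N (MulOpposite.op (idemClass I x))) :=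
      iSup₂_le fun y hy m hm => op_idemClass_smul_of_mem_of_ne I hy hm
    exact h hn'
  · rw [eq_top_iff]
    intro n _
    have h : n = ∑ x : Q, MulOpposite.op (idemClass I x) • n := by
      rw [← Finset.sum_smul, ← Finset.op_sum, sum_idemClass, MulOpposite.op_one, one_smul]
    rw [h]
    exact Submodule.sum_mem _ fun x _ => Submodule.mem_iSup_of_mem x ⟨n, rfl⟩

open Classical in
/-- The basis of a module composed of bases of its parts at the vertices. -/
def vertexBasis (b : ∀ x, Module.Basis (Fin (dimVec I N x)) ℤ (vertexPart I N x)) :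
    Module.Basis (Σ x, Fin (dimVec I N x)) ℤ N :=
  (isInternal_vertexPart I).collectedBasis b

theorem vertexBasis_apply (b : ∀ x, Module.Basis (Fin (dimVec I N x)) ℤ (vertexPart I N x))
    (x : Q) (i : Fin (dimVec I N x)) : vertexBasis I b ⟨x, i⟩ = b x i := by
  classical
  simp [vertexBasis]

variable {K : Type*} [Field K]
  (b : ∀ x, Module.Basis (Fin (dimVec I N x)) ℤ (vertexPart I N x))

/-- The inclusion of `K ^ d` as the part of `K ⊗ N` at the vertex `x`. -/
abbrev vertexInclusion (K : Type*) [Field K]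
    (b : ∀ x, Module.Basis (Fin (dimVec I N x)) ℤ (vertexPart I N x)) (x : Q) :
    (Fin (dimVec I N x) → K) →ₗ[K] K ⊗[ℤ] N :=
  Fintype.linearCombination K fun i => (1 : K) ⊗ₜ[ℤ] (b x i : N)

theorem equivFun_symm_vertexBasis (c : ∀ x, Fin (dimVec I N x) → K) :
    (basisOver K (vertexBasis I b)).equivFun.symm (fun p => c p.1 p.2) =
      ∑ x, vertexInclusion I K b x (c x) := by
  rw [Module.Basis.equivFun_symm_apply, Fintype.sum_sigma]
  refine Finset.sum_congr rfl fun x _ => ?_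
  rw [Fintype.linearCombination_apply]
  refine Finset.sum_congr rfl fun i _ => ?_
  rw [Algebra.TensorProduct.basis_apply, vertexBasis_apply]

open Classical in
theorem op_idemClass_smul_vertexInclusion (x y : Q) (c : Fin (dimVec I N y) → K) :
    MulOpposite.op ((1 : K) ⊗ₜ[ℤ] idemClass I x) • vertexInclusion I K b y c =
      if y = x then vertexInclusion I K b y c else 0 := by
  rw [op_one_tmul_smul, Fintype.linearCombination_apply, map_sum]
  split_ifs with h
  · subst h
    refine Finset.sum_congr rfl fun i _ => ?_
    rw [map_smul, LinearMap.baseChange_tmul]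
    congr 2
    exact op_idemClass_smul_of_mem I (b y i).2
  · refine Finset.sum_eq_zero fun i _ => ?_
    rw [map_smul, LinearMap.baseChange_tmul]
    have : rightActionHom (PathAlgebra ℤ Q ⧸ I) N (MulOpposite.op (idemClass I x))
        (b y i : N) = 0 := op_idemClass_smul_of_mem_of_ne I h (b y i).2
    rw [this, TensorProduct.tmul_zero, smul_zero]

theorem op_idemClass_smul_eq_vertexInclusion (x : Q) (z : K ⊗[ℤ] N) :
    MulOpposite.op ((1 : K) ⊗ₜ[ℤ] idemClass I x) • z =
      vertexInclusion I K b x (fun i => (basisOver K (vertexBasis I b)).equivFun z ⟨x, i⟩) := by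
  have h : z = ∑ y, vertexInclusion I K b y
      (fun i => (basisOver K (vertexBasis I b)).equivFun z ⟨y, i⟩) := by
    rw [← equivFun_symm_vertexBasis]
    exact ((basisOver K (vertexBasis I b)).equivFun.symm_apply_apply z).symm
  conv_lhs => rw [h]
  classical
  rw [Finset.smul_sum]
  simp only [op_idemClass_smul_vertexInclusion]
  rw [Finset.sum_ite_eq' Finset.univ x]
  simp

variable {e : Q → ℕ} (B : ∀ x, Matrix (Fin (e x)) (Fin (dimVec I N x)) K)

open Classical in
theorem columnMap_blockColumns (y : (Σ x, Fin (e x)) → K) :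
    columnMap (vertexBasis I b) (blockColumns B) y =
      ∑ x, vertexInclusion I K b x (Matrix.vecMul (fun i => y ⟨x, i⟩) (B x)) := by
  rw [← equivFun_symm_vertexBasis]
  refine (basisOver K (vertexBasis I b)).equivFun.injective ?_
  rw [LinearEquiv.apply_symm_apply, Module.Basis.equivFun_apply,
    ← LinearMap.toMatrix_mulVec_repr (Pi.basisFun K _) (basisOver K (vertexBasis I b)),
    LinearMap.toMatrix_toLin]
  funext p
  exact blockColumns_mulVec B y p

open Classical in
/-- A submodule of `K ⊗ N` is determined by its parts at the vertices: they are the row spaces of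
the matrices `B x` if and only if the submodule is the column space of the block matrix. -/
theorem restrictScalars_eq_range_columnMap_iff
    (U : Submodule (K ⊗[ℤ] (PathAlgebra ℤ Q ⧸ I))ᵐᵒᵖ (K ⊗[ℤ] N)) :
    U.restrictScalars K = LinearMap.range (columnMap (vertexBasis I b) (blockColumns B)) ↔
      ∀ x, Submodule.span K (Set.range (B x).row) = localSubspace I K (b x) U := by
  constructor
  · intro hU x
    ext c
    rw [mem_span_row_iff]
    change _ ↔ vertexInclusion I K b x c ∈ U.restrictScalars K
    have hc : vertexInclusion I K b x c = ∑ y, vertexInclusion I K b y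
        (Pi.single (M := fun x => Fin (dimVec I N x) → K) x c y) := by
      rw [Finset.sum_eq_single x]
      · rw [Pi.single_eq_same]
      · intro y _ hy
        rw [Pi.single_eq_of_ne hy, map_zero]
      · simp
    rw [hU, LinearMap.mem_range]
    constructor
    · rintro ⟨y, hy⟩
      refine ⟨fun p => Pi.single (M := fun x => Fin (e x) → K) x y p.1 p.2, ?_⟩
      rw [columnMap_blockColumns, hc]
      refine Finset.sum_congr rfl fun x' _ => ?_
      by_cases hx : x' = x
      · subst hx
        simp [hy]
      · dsimp only
        rw [Pi.single_eq_of_ne hx, Pi.single_eq_of_ne hx]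
        exact congrArg _ (Matrix.zero_vecMul _)
    · rintro ⟨y, hy⟩
      rw [columnMap_blockColumns, hc, ← equivFun_symm_vertexBasis, ← equivFun_symm_vertexBasis,
        EmbeddingLike.apply_eq_iff_eq] at hy
      refine ⟨fun i => y ⟨x, i⟩, ?_⟩
      funext j
      have := congrFun hy ⟨x, j⟩
      simpa using this
  · intro hU
    refine le_antisymm ?_ ?_
    · intro u hu
      have h1 : ∀ x, ∃ y, Matrix.vecMul y (B x) =
          fun i => (basisOver K (vertexBasis I b)).equivFun u ⟨x, i⟩ := by
        intro x
        rw [← mem_span_row_iff, hU x]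
        change vertexInclusion I K b x _ ∈ U
        rw [← op_idemClass_smul_eq_vertexInclusion]
        exact U.smul_mem _ hu
      choose y hy using h1
      refine ⟨fun p => y p.1 p.2, ?_⟩
      rw [columnMap_blockColumns]
      simp only [hy]
      rw [← equivFun_symm_vertexBasis]
      exact (basisOver K (vertexBasis I b)).equivFun.symm_apply_apply u
    · rintro _ ⟨y, rfl⟩
      rw [columnMap_blockColumns]
      refine Submodule.sum_mem _ fun x _ => ?_
      have h1 : Matrix.vecMul (fun i => y ⟨x, i⟩) (B x) ∈ localSubspace I K (b x) U := by
        rw [← hU x, mem_span_row_iff]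
        exact ⟨_, rfl⟩
      exact h1

end Vertices

/-! ### The extension set in a chart -/

section ExtensionSet

open Classical

variable {Q : Type*} [Quiver Q] [Fintype Q] (I : Ideal (PathAlgebra ℤ Q)) [I.IsTwoSided]
  {N₁ N₂ M : Type*}
  [AddCommGroup N₁] [Module (PathAlgebra ℤ Q ⧸ I)ᵐᵒᵖ N₁]
  [AddCommGroup N₂] [Module (PathAlgebra ℤ Q ⧸ I)ᵐᵒᵖ N₂]
  [AddCommGroup M] [Module (PathAlgebra ℤ Q ⧸ I)ᵐᵒᵖ M]
  {G J₂ : Type*} [Fintype J₂] (α : G → PathAlgebra ℤ Q ⧸ I)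
  (b₁ : ∀ x, Module.Basis (Fin (dimVec I N₁ x)) ℤ (vertexPart I N₁ x))
  (ν₂ : Module.Basis J₂ ℤ N₂)
  (b : ∀ x, Module.Basis (Fin (dimVec I M x)) ℤ (vertexPart I M x))
  {K : Type*} [Field K] (s : ∀ x, Fin (dimVec I N₁ x) ↪o Fin (dimVec I M x))
  (B : ∀ x, Matrix (Fin (dimVec I N₁ x)) (Fin (dimVec I M x)) K)
  (hB : ∀ x, (B x).submatrix id (s x) = 1)

theorem mulVec_col_eq_zero {ε κ κ' P : Type*} [CommRing P] [Fintype κ] {A : Matrix ε κ P}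
    {Z : Matrix κ κ' P} (h : A * Z = 0) (k : κ') : A.mulVec (fun p => Z p k) = 0 := by
  funext i
  exact congrFun (congrFun h i) k

/-- The row spaces of the matrices `B x` form a submodule in the extension set if both linear
systems have solutions which are generically of maximal rank. -/
theorem rowGr_mem_extensionSet (hα : Submodule.span ℤ (Set.range α) = ⊤)
    (hcard : Fintype.card (Σ x, Fin (dimVec I N₁ x)) + Fintype.card J₂ =
      Fintype.card (Σ x, Fin (dimVec I M x)))
    (h₁ : ∃ Z, subSystem (fun t => actionMatrixOver K (vertexBasis I b) (α t))
        (fun t => actionMatrixOver K (vertexBasis I b₁) (α t)) (blockColumns B) * Z = 0 ∧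
      ∃ c, genericDet Z c ≠ 0)
    (h₂ : ∃ Z, quotSystem (fun t => actionMatrixOver K (vertexBasis I b) (α t))
        (fun t => actionMatrixOver K ν₂ (α t)) (blockColumns B) * Z = 0 ∧
      ∃ c, genericDet Z c ≠ 0) :
    (fun x => rowGr (B x) (s x) (hB x)) ∈ extensionSet I K N₁ N₂ M b := by
  obtain ⟨Z₁, hZ₁, c₁, hc₁⟩ := h₁
  obtain ⟨Z₂, hZ₂, c₂, hc₂⟩ := h₂
  obtain ⟨B', hB'⟩ := exists_mul_blockColumns_eq_one B s hB
  have hinj := columnMap_injective (vertexBasis I b) hB'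
  obtain ⟨U, hU, he₁⟩ := exists_submodule_equiv_of_genericDet_ne_zero α hα (vertexBasis I b)
    (vertexBasis I b₁) (blockColumns B) hinj Z₁
    (fun k => (subSystem_mulVec_eq_zero_iff _ _ _ _).1 (mulVec_col_eq_zero hZ₁ k)) c₁ hc₁
  have hfin := finrank_quotient_of_range_columnMap (vertexBasis I b) hinj U hU
  have he₂ := nonempty_quotient_equiv_of_genericDet_ne_zero α hα (vertexBasis I b) ν₂
    (blockColumns B) U hU (by omega) Z₂
    (fun k => ((quotSystem_mulVec_eq_zero_iff _ _ _ _).1 (mulVec_col_eq_zero hZ₂ k)).1)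
    (fun k => ((quotSystem_mulVec_eq_zero_iff _ _ _ _).1 (mulVec_col_eq_zero hZ₂ k)).2) c₂ hc₂
  exact ⟨U, he₁, he₂, (restrictScalars_eq_range_columnMap_iff I b B U).1 hU⟩

/-- If the row spaces of the matrices `B x` form a submodule in the extension set, then the ranks of
`N₁` and `N₂` add up to that of `M`, the ranks of both linear systems are determined by the
dimensions of the endomorphism rings of `N₁^{(K)}` and `N₂^{(K)}`, and both systems have solutions
of maximal rank. -/
theorem exists_solutions_of_rowGr_mem_extensionSet
    (h : (fun x => rowGr (B x) (s x) (hB x)) ∈ extensionSet I K N₁ N₂ M b) :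
    (Fintype.card (Σ x, Fin (dimVec I N₁ x)) + Fintype.card J₂ =
      Fintype.card (Σ x, Fin (dimVec I M x))) ∧
    ((subSystem (fun t => actionMatrixOver K (vertexBasis I b) (α t))
        (fun t => actionMatrixOver K (vertexBasis I b₁) (α t)) (blockColumns B)).rank =
      (subSystem (fun t => actionMatrixOver K (vertexBasis I b₁) (α t))
        (fun t => actionMatrixOver K (vertexBasis I b₁) (α t)) 1).rank ∧
    ∃ z, (subSystem (fun t => actionMatrixOver K (vertexBasis I b) (α t))
        (fun t => actionMatrixOver K (vertexBasis I b₁) (α t)) (blockColumns B)).mulVec z = 0 ∧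
      ∃ c : (Σ x, Fin (dimVec I N₁ x)) → (Σ x, Fin (dimVec I N₁ x)),
        (Matrix.of fun i j => z (i, c j)).det ≠ 0) ∧
    ((quotSystem (fun t => actionMatrixOver K (vertexBasis I b) (α t))
        (fun t => actionMatrixOver K ν₂ (α t)) (blockColumns B)).rank + Fintype.card (J₂ × J₂) =
      (subSystem (fun t => actionMatrixOver K ν₂ (α t))
        (fun t => actionMatrixOver K ν₂ (α t)) 1).rank +
          Fintype.card (J₂ × Σ x, Fin (dimVec I M x)) ∧
    ∃ z, (quotSystem (fun t => actionMatrixOver K (vertexBasis I b) (α t))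
        (fun t => actionMatrixOver K ν₂ (α t)) (blockColumns B)).mulVec z = 0 ∧
      ∃ c : J₂ → (Σ x, Fin (dimVec I M x)), (Matrix.of fun i j => z (i, c j)).det ≠ 0) := by
  obtain ⟨U, ⟨e₁⟩, ⟨e₂⟩, hW⟩ := h
  have hU := (restrictScalars_eq_range_columnMap_iff I b B U).2 hW
  obtain ⟨B', hB'⟩ := exists_mul_blockColumns_eq_one B s hB
  have hinj := columnMap_injective (vertexBasis I b) hB'
  obtain ⟨Φ, hdet, hΦ⟩ := exists_intertwiner_of_equiv (vertexBasis I b) (vertexBasis I b₁)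
    (blockColumns B) hinj U hU e₁
  obtain ⟨Θ, hΘ, hΘB, ⟨H, hH⟩, hker⟩ := exists_intertwiner_of_quotient_equiv (vertexBasis I b) ν₂
    (blockColumns B) U hU e₂
  obtain ⟨c, hc⟩ := exists_det_submatrix_ne_zero hH
  refine ⟨?_, ⟨rank_subSystem _ _ _ B' hB' Φ hdet fun t => hΦ (α t), fun p => Φ p.1 p.2, ?_, id,
    hdet.ne_zero⟩, rank_quotSystem _ _ _ Θ H hH (fun t => hΘ (α t)) hΘB hker, fun p => Θ p.1 p.2,
    ?_, c, hc⟩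
  · have hfin := finrank_quotient_of_range_columnMap (vertexBasis I b) hinj U hU
    rw [(e₂.restrictScalars K).finrank_eq, Module.finrank_eq_card_basis (basisOver K ν₂)] at hfin
    omega
  · exact (subSystem_mulVec_eq_zero_iff _ _ _ _).2 fun t => hΦ (α t)
  · exact (quotSystem_mulVec_eq_zero_iff _ _ _ _).2 ⟨fun t => hΘ (α t), hΘB⟩

end ExtensionSet

section Assembly

universe w

theorem map_map_castRingHom {P K m n : Type*} [CommRing P] [CommRing K] (φ : P →+* K)
    (A : Matrix m n ℤ) : (A.map (Int.castRingHom P)).map φ = A.map (Int.castRingHom K) := by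
  ext i j
  simp

open Classical in
theorem map_blockColumns {V P P' : Type*} [Zero P] [Zero P'] {e d : V → ℕ}
    (B : ∀ x, Matrix (Fin (e x)) (Fin (d x)) P) (φ : P → P') (hφ : φ 0 = 0) :
    (blockColumns B).map φ = blockColumns fun x => (B x).map φ := by
  rw [blockColumns, Matrix.transpose_map, Matrix.blockDiagonal'_map _ _ hφ]

open Classical in
/-- In the chart `T_s = 1`, the conditions that a point lies on the image of the product of
Grassmannians and in the extension set are given by finitely many integral polynomials. -/
theorem exists_isLocClosedPoint_extensionSet {Q : Type*} [Quiver Q] [Fintype Q]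
    (I : Ideal (PathAlgebra ℤ Q)) [I.IsTwoSided] {N₁ N₂ M : Type*}
    [AddCommGroup N₁] [Module (PathAlgebra ℤ Q ⧸ I)ᵐᵒᵖ N₁]
    [AddCommGroup N₂] [Module (PathAlgebra ℤ Q ⧸ I)ᵐᵒᵖ N₂]
    [AddCommGroup M] [Module (PathAlgebra ℤ Q ⧸ I)ᵐᵒᵖ M]
    {G J₂ : Type*} [Fintype G] [Fintype J₂] (α : G → PathAlgebra ℤ Q ⧸ I)
    (hα : Submodule.span ℤ (Set.range α) = ⊤)
    (b₁ : ∀ x, Module.Basis (Fin (dimVec I N₁ x)) ℤ (vertexPart I N₁ x))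
    (ν₂ : Module.Basis J₂ ℤ N₂)
    (b : ∀ x, Module.Basis (Fin (dimVec I M x)) ℤ (vertexPart I M x)) (S : Finset ℕ) (r₁ r₂ : ℕ)
    (hr₁ : ∀ (K : Type w) [Field K], ringChar K ∉ S →
      (subSystem (fun t => actionMatrixOver K (vertexBasis I b₁) (α t))
        (fun t => actionMatrixOver K (vertexBasis I b₁) (α t)) 1).rank = r₁)
    (hr₂ : ∀ (K : Type w) [Field K], ringChar K ∉ S →
      (subSystem (fun t => actionMatrixOver K ν₂ (α t))
        (fun t => actionMatrixOver K ν₂ (α t)) 1).rank = r₂)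
    (s : ∀ x, Fin (dimVec I N₁ x) ↪o Fin (dimVec I M x)) :
    ∃ F H : Finset (MvPolynomial (∀ x, Fin (dimVec I N₁ x) ↪o Fin (dimVec I M x)) ℤ),
      ∀ (K : Type w) [Field K], ringChar K ∉ S →
      ∀ (v : (∀ x, Fin (dimVec I N₁ x) ↪o Fin (dimVec I M x)) → K) (hv : v ≠ 0), v s = 1 →
        (Projectivization.mk K v hv ∈
          (fun W => segre fun x => plucker (W x)) '' extensionSet I K N₁ N₂ M b ↔
            IsLocClosedPoint F H v) := by
  by_cases hcard : Fintype.card (Σ x, Fin (dimVec I N₁ x)) + Fintype.card J₂ =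
      Fintype.card (Σ x, Fin (dimVec I M x))
  swap
  -- If the ranks do not add up, the extension set is empty.
  · refine ⟨∅, ∅, fun K _ hK v hv hvs => iff_of_false ?_ ?_⟩
    · rw [mem_image_segre_plucker_iff _ s v hv hvs]
      rintro ⟨hB, _, hE⟩
      exact hcard (exists_solutions_of_rowGr_mem_extensionSet I α b₁ ν₂ b s _ hB hE).1
    · rintro ⟨_, g, hg, _⟩
      exact Finset.notMem_empty g hg
  let σ := ∀ x, Fin (dimVec I N₁ x) ↪o Fin (dimVec I M x)
  let ρ := fun t => (actionMatrix (vertexBasis I b) (α t)).map (Int.castRingHom (MvPolynomial σ ℤ))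
  let ρ₁ := fun t =>
    (actionMatrix (vertexBasis I b₁) (α t)).map (Int.castRingHom (MvPolynomial σ ℤ))
  let ρ₂ := fun t => (actionMatrix ν₂ (α t)).map (Int.castRingHom (MvPolynomial σ ℤ))
  obtain ⟨F₀, hF₀⟩ := exists_chart_equations s
  obtain ⟨F₁, H₁, h₁⟩ := exists_isLocClosedPoint_linearSystem
    (subSystem ρ ρ₁ (blockColumns (chartMatrix s))) r₁
  -- The rank prescribed here is that of `rank_quotSystem`. Should the difference of natural numbers
  -- be truncated, then the extension set does not meet the chart for any admissible `K`.
  obtain ⟨F₂, H₂, h₂⟩ := exists_isLocClosedPoint_linearSystem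
    (quotSystem ρ ρ₂ (blockColumns (chartMatrix s)))
    (r₂ + Fintype.card (J₂ × Σ x, Fin (dimVec I M x)) - Fintype.card (J₂ × J₂))
  refine ⟨F₀ ∪ (F₁ ∪ F₂), Finset.image₂ (· * ·) H₁ H₂, fun K _ hK v hv hvs => ?_⟩
  have hloc : IsLocClosedPoint (F₀ ∪ (F₁ ∪ F₂)) (Finset.image₂ (· * ·) H₁ H₂) v ↔
      (∀ f ∈ F₀, MvPolynomial.aeval v f = 0) ∧ IsLocClosedPoint F₁ H₁ v ∧
        IsLocClosedPoint F₂ H₂ v := by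
    rw [← isLocClosedPoint_union_image₂_mul]
    constructor
    · rintro ⟨hF, hH⟩
      exact ⟨fun f hf => hF f (Finset.mem_union_left _ hf),
        fun f hf => hF f (Finset.mem_union_right _ hf), hH⟩
    · rintro ⟨h0, h1, hH⟩
      exact ⟨fun f hf => (Finset.mem_union.1 hf).elim (h0 f) (h1 f), hH⟩
  rw [mem_image_segre_plucker_iff _ s v hv hvs, hloc, hF₀]
  set B := fun x => (chartMatrix s x).map (MvPolynomial.aeval v : _ →ₐ[ℤ] K) with hBdef
  have hblock : (blockColumns (chartMatrix s)).map (MvPolynomial.aeval v : _ →ₐ[ℤ] K).toRingHom =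
      blockColumns B := map_blockColumns _ _ (map_zero _)
  have hρ : (fun t => (ρ t).map (MvPolynomial.aeval v : _ →ₐ[ℤ] K).toRingHom) =
      fun t => actionMatrixOver K (vertexBasis I b) (α t) := funext fun t => map_map_castRingHom _ _
  have hρ₁ : (fun t => (ρ₁ t).map (MvPolynomial.aeval v : _ →ₐ[ℤ] K).toRingHom) =
      fun t => actionMatrixOver K (vertexBasis I b₁) (α t) :=
    funext fun t => map_map_castRingHom _ _
  have hρ₂ : (fun t => (ρ₂ t).map (MvPolynomial.aeval v : _ →ₐ[ℤ] K).toRingHom) =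
      fun t => actionMatrixOver K ν₂ (α t) := funext fun t => map_map_castRingHom _ _
  have hm₁ : (subSystem ρ ρ₁ (blockColumns (chartMatrix s))).map
      (MvPolynomial.aeval v : _ →ₐ[ℤ] K) =
      subSystem (fun t => actionMatrixOver K (vertexBasis I b) (α t))
        (fun t => actionMatrixOver K (vertexBasis I b₁) (α t)) (blockColumns B) := by
    have := map_subSystem (MvPolynomial.aeval v : _ →ₐ[ℤ] K).toRingHom ρ ρ₁
      (blockColumns (chartMatrix s))
    rw [hρ, hρ₁, hblock] at this
    exact this
  have hm₂ : (quotSystem ρ ρ₂ (blockColumns (chartMatrix s))).map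
      (MvPolynomial.aeval v : _ →ₐ[ℤ] K) =
      quotSystem (fun t => actionMatrixOver K (vertexBasis I b) (α t))
        (fun t => actionMatrixOver K ν₂ (α t)) (blockColumns B) := by
    have := map_quotSystem (MvPolynomial.aeval v : _ →ₐ[ℤ] K).toRingHom ρ ρ₂
      (blockColumns (chartMatrix s))
    rw [hρ, hρ₂, hblock] at this
    exact this
  have h₁' := h₁ K v
  have h₂' := h₂ K v
  rw [hm₁] at h₁'
  rw [hm₂] at h₂'
  constructor
  · rintro ⟨hB, hBv, hE⟩
    obtain ⟨-, ⟨hrk₁, z₁, hz₁, c₁, hc₁⟩, hrk₂, z₂, hz₂, c₂, hc₂⟩ :=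
      exists_solutions_of_rowGr_mem_extensionSet I α b₁ ν₂ b s B hB hE
    rw [hr₁ K hK] at hrk₁
    rw [hr₂ K hK] at hrk₂
    exact ⟨⟨hB, hBv⟩, h₁'.2 hrk₁ z₁ hz₁ c₁ hc₁, h₂'.2 (by omega) z₂ hz₂ c₂ hc₂⟩
  · rintro ⟨⟨hB, hBv⟩, hL₁, hL₂⟩
    exact ⟨hB, hBv, rowGr_mem_extensionSet I α b₁ ν₂ b s B hB hα hcard (h₁'.1 hL₁) (h₂'.1 hL₂)⟩

open Classical in
/-- The extension set, glued from its descriptions in the charts. -/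
theorem exists_projZeros_diff_eq_extensionSet {Q : Type*} [Quiver Q] [Fintype Q]
    (I : Ideal (PathAlgebra ℤ Q)) [I.IsTwoSided] {N₁ N₂ M : Type*}
    [AddCommGroup N₁] [Module (PathAlgebra ℤ Q ⧸ I)ᵐᵒᵖ N₁]
    [AddCommGroup N₂] [Module (PathAlgebra ℤ Q ⧸ I)ᵐᵒᵖ N₂]
    [AddCommGroup M] [Module (PathAlgebra ℤ Q ⧸ I)ᵐᵒᵖ M]
    {G J₂ : Type*} [Fintype G] [Fintype J₂] (α : G → PathAlgebra ℤ Q ⧸ I)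
    (hα : Submodule.span ℤ (Set.range α) = ⊤)
    (b₁ : ∀ x, Module.Basis (Fin (dimVec I N₁ x)) ℤ (vertexPart I N₁ x))
    (ν₂ : Module.Basis J₂ ℤ N₂)
    (b : ∀ x, Module.Basis (Fin (dimVec I M x)) ℤ (vertexPart I M x)) (S : Finset ℕ) (r₁ r₂ : ℕ)
    (hr₁ : ∀ (K : Type w) [Field K], ringChar K ∉ S →
      (subSystem (fun t => actionMatrixOver K (vertexBasis I b₁) (α t))
        (fun t => actionMatrixOver K (vertexBasis I b₁) (α t)) 1).rank = r₁)
    (hr₂ : ∀ (K : Type w) [Field K], ringChar K ∉ S →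
      (subSystem (fun t => actionMatrixOver K ν₂ (α t))
        (fun t => actionMatrixOver K ν₂ (α t)) 1).rank = r₂) :
    ∃ (m n : ℕ) (F : Fin m → MvPolynomial (∀ x, Fin (dimVec I N₁ x) ↪o Fin (dimVec I M x)) ℤ)
      (H : Fin n → MvPolynomial (∀ x, Fin (dimVec I N₁ x) ↪o Fin (dimVec I M x)) ℤ),
      (∀ i, ∃ d, (F i).IsHomogeneous d) ∧ (∀ j, ∃ d, (H j).IsHomogeneous d) ∧
      ∀ (K : Type w) [Field K], ringChar K ∉ S →
        (fun W => segre fun x => plucker (W x)) '' extensionSet I K N₁ N₂ M b =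
          projZeros K F \ projZeros K H := by
  let σ := ∀ x, Fin (dimVec I N₁ x) ↪o Fin (dimVec I M x)
  -- The family of sets is kept abstract, since unification would otherwise unfold it.
  let E : ∀ (K : Type w) [Field K], Set (ℙ K (σ → K)) := fun K _ =>
    (fun W => segre fun x => plucker (W x)) '' extensionSet I K N₁ N₂ M b
  have hE : ∀ (K : Type w) [Field K],
    (fun W => segre fun x => plucker (W x)) '' extensionSet I K N₁ N₂ M b = E K := fun K _ => rfl
  clear_value E
  have hchart : ∀ s, ∃ F H : Finset (MvPolynomial σ ℤ), ∀ (K : Type w) [Field K],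
      ringChar K ∉ S → ∀ (v : σ → K) (hv : v ≠ 0), v s = 1 →
        (Projectivization.mk K v hv ∈ E K ↔ IsLocClosedPoint F H v) := by
    intro s
    obtain ⟨F, H, h⟩ := exists_isLocClosedPoint_extensionSet I α hα b₁ ν₂ b S r₁ r₂ hr₁ hr₂ s
    refine ⟨F, H, fun K _ hK v hv hvs => ?_⟩
    rw [← hE]
    exact h K hK v hv hvs
  obtain ⟨m, n, F, H, hF, hH, h⟩ := exists_projZeros_diff_of_charts S E hchart
  refine ⟨m, n, F, H, hF, hH, fun K _ hK => ?_⟩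
  rw [hE]
  exact h K hK

/-- The dimension of the endomorphism ring of `K ⊗ N` is the same for all fields `K` outside
finitely many positive characteristics. It is expressed here by the rank of the linear system for
the endomorphisms. -/
theorem exists_rank_endSystem_eq {A N G J : Type*} [Ring A] [AddCommGroup N] [Module Aᵐᵒᵖ N]
    [Fintype G] [Fintype J] (ν : Module.Basis J ℤ N) (α : G → A) :
    ∃ (S : Finset ℕ) (r : ℕ), (∀ p ∈ S, p.Prime) ∧ ∀ (_ : DecidableEq J) (K : Type*) [Field K],
      ringChar K ∉ S →
      (subSystem (fun t => actionMatrixOver K ν (α t)) (fun t => actionMatrixOver K ν (α t)) 1).rank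
        = r := by
  classical
  obtain ⟨S, r, hS, hr⟩ := exists_rank_map_intCast_eq
    (subSystem (fun t => actionMatrix ν (α t)) (fun t => actionMatrix ν (α t)) 1)
  refine ⟨S, r, hS, fun inst K _ hK => ?_⟩
  obtain rfl : inst = Classical.decEq J := Subsingleton.elim _ _
  rw [← hr K hK, map_subSystem, Matrix.map_one _ (map_zero _) (map_one _)]

end Assembly

end

theorem mainTheorem4 {Q : Type*} [Quiver Q] [Fintype Q] [∀ x y : Q, Finite (x ⟶ y)]
    (I : Ideal (PathAlgebra ℤ Q)) [I.IsTwoSided] (hA : IsZOrder (PathAlgebra ℤ Q ⧸ I))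
    (N₁ N₂ M : Type*)
    [AddCommGroup N₁] [Module (PathAlgebra ℤ Q ⧸ I)ᵐᵒᵖ N₁]
    [AddCommGroup N₂] [Module (PathAlgebra ℤ Q ⧸ I)ᵐᵒᵖ N₂]
    [AddCommGroup M] [Module (PathAlgebra ℤ Q ⧸ I)ᵐᵒᵖ M]
    (hN₁ : IsLattice (PathAlgebra ℤ Q ⧸ I) N₁) (hN₂ : IsLattice (PathAlgebra ℤ Q ⧸ I) N₂)
    (hM : IsLattice (PathAlgebra ℤ Q ⧸ I) M)
    (b : ∀ x, Module.Basis (Fin (dimVec I M x)) ℤ (vertexPart I M x)) :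
    ∃ (S : Finset ℕ) (r s : ℕ)
      (F : Fin r → MvPolynomial (∀ x, Fin (dimVec I N₁ x) ↪o Fin (dimVec I M x)) ℤ)
      (G : Fin s → MvPolynomial (∀ x, Fin (dimVec I N₁ x) ↪o Fin (dimVec I M x)) ℤ),
      (∀ p ∈ S, p.Prime) ∧
      (∀ i, ∃ n, (F i).IsHomogeneous n) ∧ (∀ j, ∃ n, (G j).IsHomogeneous n) ∧
      ∀ (K : Type*) [Field K], ringChar K ∉ S →
        (fun W => segre fun x => plucker (W x)) '' extensionSet I K N₁ N₂ M b =
          projZeros K F \ projZeros K G := by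
  classical
  obtain ⟨_, _⟩ := hA
  obtain ⟨_, _⟩ := hN₁
  obtain ⟨_, _⟩ := hN₂
  obtain ⟨k, α, hα⟩ := Module.Finite.exists_fin (R := ℤ) (M := PathAlgebra ℤ Q ⧸ I)
  obtain ⟨b₁⟩ : Nonempty (∀ x, Module.Basis (Fin (dimVec I N₁ x)) ℤ (vertexPart I N₁ x)) :=
    ⟨fun x => Module.finBasis ℤ (vertexPart I N₁ x)⟩
  obtain ⟨k₂, ⟨ν₂⟩⟩ : ∃ k, Nonempty (Module.Basis (Fin k) ℤ N₂) := ⟨_, ⟨Module.finBasis ℤ N₂⟩⟩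
  obtain ⟨S₁, r₁, hS₁, hr₁⟩ := exists_rank_endSystem_eq (vertexBasis I b₁) α
  obtain ⟨S₂, r₂, hS₂, hr₂⟩ := exists_rank_endSystem_eq ν₂ α
  obtain ⟨m, n, F, G, hF, hG, h⟩ :=
    exists_projZeros_diff_eq_extensionSet I α hα b₁ ν₂ b (S₁ ∪ S₂) r₁ r₂
      (fun K _ hK => hr₁ _ K fun h => hK (Finset.mem_union_left _ h))
      (fun K _ hK => hr₂ _ K fun h => hK (Finset.mem_union_right _ h))
  exact ⟨S₁ ∪ S₂, m, n, F, G, fun p hp => (Finset.mem_union.1 hp).elim (hS₁ p) (hS₂ p), hF, hG, h⟩
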